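/- Let $T>0$ and let $(\Omega,\mathcal F,(\mathcal F_t),P)$ be a filtered probability space carrying an $m$-dimensional Wiener process $\mathbf w$ on $[0,T]$ with respect to $(\mathcal F_t)$. For $0\le s\le t\le T$ let $\mathcal F_{s,t}$ be the $\sigma$-algebra generated by the increments $\mathbf w_v-\mathbf w_u$, $s\le u\le v\le t$. Let $\boldsymbol f:\mathbb R^d\times\mathbb R\to\mathbb R^d$ be in $\mathcal C_b^{\infty,1}$: $\boldsymbol f(\cdot,t)$ is $C^\infty$ for every $t$, $\boldsymbol f(\mathbf x,\cdot)$ is $C^1$ for every $\mathbf x$, and $\partial_t\boldsymbol f$ and, for every $k\ge 1$, the $k$-th derivative of $\boldsymbol f$ in $\mathbf x$ are bounded on $\mathbb R^d\times\mathbb R$. Let $\boldsymbol g:\mathbb R\to\mathbb R^{d\times m}$ be in $\mathcal C_b^1$: it is $C^1$ with bounded derivative. Let $\mathcal L:\mathbb R^d\to\mathbb R$ be differentiable. Let $\mathbf x=(\mathbf x_t)_{t\in[0,T]}$ be an $(\mathcal F_t)$-adapted (up to null sets) process with almost surely continuous paths that solves the Stratonovich SDE $$\mathrm d\mathbf x_t=\boldsymbol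 f(\mathbf x_t,t)\,\mathrm dt+\boldsymbol g(t)\circ\mathrm d\mathbf w_t$$ with (possibly random) initial condition $\mathbf x_0$. Here the Stratonovich integral $\int_s^t Y_u\circ\mathrm d\mathbf w_u$ is the limit in probability of the sums $\sum_k\tfrac12(Y_{t_k}+Y_{t_{k-1}})(\mathbf w_{t_k}-\mathbf w_{t_{k-1}})$ over partitions of $[s,t]$ as the mesh tends to $0$. By a stochastic flow of the SDE we mean a family $\Phi_{s,t}(\xi)$, $0\le s\le t\le T$, $\xi\in\mathbb R^d$, of random variables that is almost surely jointly continuous in $(s,t,\xi)$ and such that, for all $s$ and $\xi$, the process $t\mapsto\Phi_{s,t}(\xi)$ is $\mathcal F_{s,t}$-adapted (up to null sets) and solves the SDE on $[s,T]$ with value $\xi$ at time $s$. Then a stochastic flow exists, and for every stochastic flow $\Phi$ the following hold. 1. Almost surely, for all $t\in[0,T]$, one has $\mathbf x_T=\Phi_{t,T}(\mathbf x_t)$ and the map $\xi\mapsto\mathcal L(\Phi_{t,T}(\xi))$ is differentiable at $\xi=\mathbf x_t$. Hence the adjoint process $\mathbf a_{\mathbf x}(t):=\partial\mathcal L(\mathbf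 x_T)/\partial\mathbf x_t:=\frac{\partial}{\partial\xi}\mathcal L(\Phi_{t,T}(\xi))\big|_{\xi=\mathbf x_t}$ (a row vector) is well defined. 2. The process $\mathbf a_{\mathbf x}$ is a strong solution of the backward-in-time ODE with random coefficients $$\mathrm d\mathbf a_{\mathbf x}(t)=-\mathbf a_{\mathbf x}(t)\,\frac{\partial\boldsymbol f}{\partial\mathbf x}(\mathbf x_t,t)\,\mathrm dt,\qquad \mathbf a_{\mathbf x}(T)=\frac{\partial\mathcal L}{\partial\mathbf x}(\mathbf x_T).$$ That is, the terminal condition holds almost surely; almost surely the path $t\mapsto\mathbf a_{\mathbf x}(t)$ is differentiable on $[0,T]$ (one-sidedly at the endpoints) and satisfies the ODE at every $t\in[0,T]$; and for each $t$, $\mathbf a_{\mathbf x}(t)$ is measurable, up to null sets, with respect to $\sigma(\mathbf x_T)\vee\mathcal F_{t,T}$. In other words, the noise term drops out of the adjoint equation. -/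

import Mathlib

open MeasureTheory ProbabilityTheory Filter Set
open scoped Topology ENNReal NNReal

noncomputable section

namespace AdjointSDE

/-- Euclidean space `ℝⁿ`. -/
abbrev E (n : ℕ) : Type := EuclideanSpace ℝ (Fin n)

/-! ### Regularity classes of the coefficients -/

/-- The class `C_b^{∞,1}`: `f(·, t)` is smooth with all derivatives of order at least one bounded
(uniformly in `(x, t)`), and `f(x, ·)` is continuously differentiable with bounded derivative
(uniformly in `(x, t)`). The function `f` itself need not be bounded. -/
structure IsCbInfOne {d : ℕ} (f : E d → ℝ → E d) : Prop where
  smooth_space : ∀ t, ContDiff ℝ (⊤ : ℕ∞) (fun x => f x t)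
  contDiff_time : ∀ x, ContDiff ℝ 1 (fun t => f x t)
  bounded_space : ∀ k : ℕ, 1 ≤ k →
    ∃ C : ℝ, ∀ x t, ‖iteratedFDeriv ℝ k (fun y => f y t) x‖ ≤ C
  bounded_time : ∃ C : ℝ, ∀ x t, ‖deriv (fun r => f x r) t‖ ≤ C

/-- The class `C_b^1` of continuously differentiable matrix-valued functions of time with bounded
derivative. A real `d × m` matrix is regarded as a linear map from `ℝᵐ` to `ℝᵈ`. -/
structure IsCbOne {d m : ℕ} (g : ℝ → E m →L[ℝ] E d) : Prop where
  contDiff : ContDiff ℝ 1 g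
  bounded : ∃ C : ℝ, ∀ t, ‖deriv g t‖ ≤ C

/-! ### Wiener processes -/

/-- `w` is an `m`-dimensional standard Wiener process on `[0, T]` with respect to the
filtration `𝓕`. -/
structure IsWienerProcess {Ω : Type*} {mΩ : MeasurableSpace Ω} (P : Measure Ω)
    (𝓕 : Filtration ℝ mΩ) (T : ℝ) {m : ℕ} (w : ℝ → Ω → E m) : Prop where
  adapted : ∀ t ∈ Icc 0 T, Measurable[𝓕 t] (w t)
  zero : ∀ᵐ ω ∂P, w 0 ω = 0
  continuous : ∀ᵐ ω ∂P, ContinuousOn (fun t => w t ω) (Icc 0 T)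
  indep : ∀ s t : ℝ, 0 ≤ s → s ≤ t → t ≤ T →
    Indep (𝓕 s) (MeasurableSpace.comap (fun ω => w t ω - w s ω) inferInstance) P
  law : ∀ s t : ℝ, 0 ≤ s → s ≤ t → t ≤ T →
    HasLaw (fun ω (i : Fin m) => w t ω i - w s ω i)
      (Measure.pi fun _ => gaussianReal 0 (t - s).toNNReal) P

/-- The two-sided filtration of `w`: the `σ`-algebra `𝓕_{s,t}` generated by the increments
`w_v - w_u` with `s ≤ u ≤ v ≤ t`. -/
abbrev incrementSigma {Ω : Type*} {m : ℕ} (w : ℝ → Ω → E m) (s t : ℝ) : MeasurableSpace Ω :=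
  ⨆ (u : ℝ) (v : ℝ) (_ : s ≤ u ∧ u ≤ v ∧ v ≤ t),
    MeasurableSpace.comap (fun ω => w v ω - w u ω) inferInstance

/-! ### The Stratonovich integral -/

/-- A partition `s = t₀ < t₁ < ⋯ < t_N = t` of the interval `[s, t]`. -/
structure Partition (s t : ℝ) where
  N : ℕ
  pt : Fin (N + 1) → ℝ
  strictMono : StrictMono pt
  first : pt 0 = s
  last : pt (Fin.last N) = t

/-- The mesh `max_k (t_k - t_{k-1})` of a partition (zero if `N = 0`). -/
def Partition.mesh {s t : ℝ} (p : Partition s t) : ℝ :=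
  ⨆ k : Fin p.N, (p.pt k.succ - p.pt k.castSucc)

/-- The symmetric Riemann sum `∑_k ½ (Y_{t_k} + Y_{t_{k-1}}) (w_{t_k} - w_{t_{k-1}})`. -/
def stratonovichSum {Ω : Type*} {d m : ℕ} (w : ℝ → Ω → E m) (Y : ℝ → Ω → E m →L[ℝ] E d)
    {s t : ℝ} (p : Partition s t) (ω : Ω) : E d :=
  ∑ k : Fin p.N, ((1 / 2 : ℝ) • (Y (p.pt k.succ) ω + Y (p.pt k.castSucc) ω))
    (w (p.pt k.succ) ω - w (p.pt k.castSucc) ω)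

/-- `I` is (a version of) the Stratonovich integral `∫_s^t Y_u ∘ dw_u`: the limit in probability of
the symmetric Riemann sums as the mesh of the partition of `[s, t]` tends to zero. -/
def IsStratonovichIntegral {Ω : Type*} {mΩ : MeasurableSpace Ω} (P : Measure Ω) {d m : ℕ}
    (w : ℝ → Ω → E m) (Y : ℝ → Ω → E m →L[ℝ] E d) (s t : ℝ) (I : Ω → E d) : Prop :=
  TendstoInMeasure P (fun p : Partition s t => stratonovichSum w Y p)
    (comap Partition.mesh (𝓝 0)) I

/-! ### The stochastic differential equation and its flow -/

/-- On the time interval `[s, T]`, the process `x` solves the Stratonovich equation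
`dx = f(x, t) dt + g(t) ∘ dw` with `x_s = ξ`. It is adapted, up to null sets, to the family `𝓖` of
`σ`-algebras. -/
structure SolvesSDE {Ω : Type*} {mΩ : MeasurableSpace Ω} (P : Measure Ω)
    (𝓖 : ℝ → MeasurableSpace Ω) {d m : ℕ} (w : ℝ → Ω → E m)
    (f : E d → ℝ → E d) (g : ℝ → E m →L[ℝ] E d) (s T : ℝ) (ξ : Ω → E d)
    (x : ℝ → Ω → E d) : Prop where
  adapted : ∀ t ∈ Icc s T, AEStronglyMeasurable[𝓖 t] (x t) P
  continuous : ∀ᵐ ω ∂P, ContinuousOn (fun t => x t ω) (Icc s T)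
  initial : ∀ᵐ ω ∂P, x s ω = ξ ω
  equation : ∀ t ∈ Icc s T, IsStratonovichIntegral P w (fun u _ => g u) s t
    (fun ω => x t ω - x s ω - ∫ u in s..t, f (x u ω) u)

/-- `Φ s t ξ ω` is the stochastic flow `Φ_{s,t}(ξ)`, `0 ≤ s ≤ t ≤ T`, of the Stratonovich equation:
the version, almost surely jointly continuous in `(s, t, ξ)`, of the solution at time `t` that
starts from the point `ξ` at time `s`. -/
structure IsStochasticFlow {Ω : Type*} {mΩ : MeasurableSpace Ω} (P : Measure Ω) {d m : ℕ}
    (w : ℝ → Ω → E m) (f : E d → ℝ → E d) (g : ℝ → E m →L[ℝ] E d) (T : ℝ)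
    (Φ : ℝ → ℝ → E d → Ω → E d) : Prop where
  continuous : ∀ᵐ ω ∂P, ContinuousOn (fun q : ℝ × ℝ × E d => Φ q.1 q.2.1 q.2.2 ω)
    {q | 0 ≤ q.1 ∧ q.1 ≤ q.2.1 ∧ q.2.1 ≤ T}
  solves : ∀ s ∈ Icc 0 T, ∀ ξ : E d,
    SolvesSDE P (incrementSigma w s) w f g s T (fun _ => ξ) (fun t => Φ s t ξ)

/-! ### The adjoint process and the adjoint equation -/

/-- The adjoint process `a_x(t) = ∂L(x_T)/∂x_t`: the derivative of `ξ ↦ L(Φ_{t,T}(ξ))` at `ξ = x_t`,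
as a row vector, i.e. a linear form on `ℝᵈ`. -/
def adjointProcess {Ω : Type*} {d : ℕ} (L : E d → ℝ) (Φ : ℝ → ℝ → E d → Ω → E d) (T : ℝ)
    (x : ℝ → Ω → E d) (t : ℝ) (ω : Ω) : E d →L[ℝ] ℝ :=
  fderiv ℝ (fun ξ => L (Φ t T ξ ω)) (x t ω)

/-- The process `a` of row vectors is a strong solution on `[0, T]` of the backward equation
`da = - aᵀ J_t dt`, `a(T) = θ`, with random matrices `J_t`. It is adapted, up to null sets, to the
(backward) family `𝓖` of `σ`-algebras and almost all of its paths solve the equation. -/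
structure IsStrongBackwardSolution {Ω : Type*} {mΩ : MeasurableSpace Ω} (P : Measure Ω)
    (𝓖 : ℝ → MeasurableSpace Ω) {d : ℕ} (T : ℝ) (J : ℝ → Ω → E d →L[ℝ] E d)
    (θ : Ω → E d →L[ℝ] ℝ) (a : ℝ → Ω → E d →L[ℝ] ℝ) : Prop where
  adapted : ∀ t ∈ Icc 0 T, AEStronglyMeasurable[𝓖 t] (a t) P
  terminal : ∀ᵐ ω ∂P, a T ω = θ ω
  equation : ∀ᵐ ω ∂P, ∀ t ∈ Icc 0 T,
    HasDerivWithinAt (fun r => a r ω) (-((a t ω).comp (J t ω))) (Icc 0 T) t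

end AdjointSDE

end

/-!
The noise enters additively and with a `C¹` coefficient. Summation by parts is exact for symmetric
Riemann sums, so the Stratonovich integral `∫_s^t g ∘ dw` is, path by path, the increment over
`[s, t]` of the continuous path `γ t = g t (w t) - ∫_0^t g' u (w u) du`
(`IsWienerProcess.isStratonovichIntegral_iff`). Almost every path of a solution of the stochastic
equation therefore solves the integral equation `x t = x s + (γ t - γ s) + ∫_s^t f (x u) u du`, in
which `γ` is a fixed continuous path and the drift is globally Lipschitz.

For a fixed continuous `γ` this is a Volterra equation. It has a unique solution on the whole line,
forward and backward from any starting time, and the solutions form a jointly continuous flow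
(`exists_isPathFlow`, `IsPathFlow.continuous`). With `γ` the noise path of `ω` this gives a
stochastic flow, and any other stochastic flow is indistinguishable from it
(`IsStochasticFlow.ae_eq_pathFlow`); measurability with respect to the increments of the noise comes
from Picard iteration (`aestronglyMeasurable_of_volterra`).

In the difference of two trajectories `γ` cancels, which is why the adjoint equation contains no
noise. If `R' = -R J` and `R T = 1`, where `J` is the space derivative of `f` along a trajectory
`X`, then along the difference `z` of a neighbouring trajectory and `X` the derivative of `R z` is
`R (z' - J z)`, of second order in `z`. Hence `R t` is the derivative of the flow from `t` to `T` at
`X t` (`IsPathFlow.exists_hasFDerivAt`), and by the chain rule the adjoint process is `DL(x T) R t`,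
a solution of the adjoint equation (`SolvesSDE.ae_exists_adjoint`). Finally, `x` on `[t, T]` is
recovered from `x T` and the increments of the noise on `[t, T]` by solving the integral equation
backwards, and the adjoint process is then obtained by solving a linear equation backwards; this is
its adaptedness (`aestronglyMeasurable_adjointProcess`).
-/

namespace AdjointSDE

/-! ### Volterra equations with a Lipschitz kernel -/

section Volterra

variable {V : Type*} [NormedAddCommGroup V] [NormedSpace ℝ V]

/-- The factorial estimate behind Picard iteration. With `d n` the difference of consecutive
iterates it yields existence, with `d n` the distance of the `n`-th iterate to a solution it yields
convergence, and with a constant sequence `d` it yields uniqueness. -/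
theorem norm_le_pow_div_factorial_of_eq_integral {a b τ K M : ℝ} (hK : 0 ≤ K)
    (hτ : τ ∈ Icc a b) (d D : ℕ → ℝ → V) (h0 : ∀ t ∈ Icc a b, ‖d 0 t‖ ≤ M)
    (hd : ∀ n, ∀ t ∈ Icc a b, d (n + 1) t = ∫ u in τ..t, D n u)
    (hD : ∀ n, ∀ u ∈ Icc a b, ‖D n u‖ ≤ K * ‖d n u‖) (n : ℕ) :
    ∀ t ∈ Icc a b, ‖d n t‖ ≤ M * ((K * |t - τ|) ^ n / n.factorial) := by
  induction n with
  | zero => simpa using h0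
  | succ n ih =>
    intro t ht
    have hsub : uIoc τ t ⊆ Icc a b := uIoc_subset_uIcc.trans (uIcc_subset_Icc hτ ht)
    have hM : 0 ≤ M := (norm_nonneg _).trans (h0 τ hτ)
    rw [hd n t ht]
    calc ‖∫ u in τ..t, D n u‖
        ≤ |∫ u in τ..t, (K * M * K ^ n / n.factorial) * |u - τ| ^ n| := by
          refine intervalIntegral.norm_integral_le_abs_of_norm_le ?_
            (Continuous.intervalIntegrable (by fun_prop) _ _)
          refine (ae_restrict_iff' measurableSet_uIoc).2 (Eventually.of_forall fun u hu => ?_)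
          refine (hD n u (hsub hu)).trans ?_
          refine (mul_le_mul_of_nonneg_left (ih u (hsub hu)) hK).trans (le_of_eq ?_)
          rw [mul_pow]; ring
      _ = M * ((K * |t - τ|) ^ (n + 1) / (n + 1).factorial) := by
          rw [intervalIntegral.integral_const_mul, abs_mul,
            intervalIntegral.abs_intervalIntegral_eq, integral_pow_abs_sub_uIoc,
            abs_of_nonneg (by positivity), abs_of_nonneg (by positivity), mul_pow,
            Nat.factorial_succ]
          push_cast
          field_simp
          ring

/-- Two continuous solutions of the same Volterra equation on an interval agree. -/
theorem eqOn_of_eq_volterra {a b τ K : ℝ} (hK : 0 ≤ K) (hτ : τ ∈ Icc a b) {F : ℝ → V → V}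
    (hFc : Continuous fun q : ℝ × V => F q.1 q.2) (hF : ∀ t y z, ‖F t y - F t z‖ ≤ K * ‖y - z‖)
    {c x y : ℝ → V} (hxc : ContinuousOn x (Icc a b)) (hyc : ContinuousOn y (Icc a b))
    (hx : ∀ t ∈ Icc a b, x t = c t + ∫ u in τ..t, F u (x u))
    (hy : ∀ t ∈ Icc a b, y t = c t + ∫ u in τ..t, F u (y u)) : EqOn x y (Icc a b) := by
  intro t ht
  obtain ⟨M, hM⟩ := isCompact_Icc.exists_bound_of_continuousOn (hxc.sub hyc)
  have hint : ∀ z : ℝ → V, ContinuousOn z (Icc a b) → ∀ s ∈ Icc a b,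
      IntervalIntegrable (fun u => F u (z u)) volume τ s := fun z hz s hs =>
    ((hFc.comp_continuousOn (continuousOn_id.prodMk hz)).mono
      (uIcc_subset_Icc hτ hs)).intervalIntegrable
  have key := norm_le_pow_div_factorial_of_eq_integral hK hτ (fun _ s => x s - y s)
    (fun _ s => F s (x s) - F s (y s)) hM
    (fun _ s hs => by
      rw [intervalIntegral.integral_sub (hint x hxc s hs) (hint y hyc s hs), hx s hs, hy s hs]
      abel)
    (fun _ s _ => hF s _ _)
  have hlim : Tendsto (fun n : ℕ => M * ((K * |t - τ|) ^ n / n.factorial)) atTop (𝓝 (M * 0)) :=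
    (FloorSemiring.tendsto_pow_div_factorial_atTop _).const_mul M
  rw [mul_zero] at hlim
  have := ge_of_tendsto' hlim fun n => key n t ht
  exact sub_eq_zero.1 (norm_le_zero_iff.1 this)

/-- The Picard iterates of the Volterra equation `x t = c t + ∫_τ^t F u (x u) du`, started from
the inhomogeneity `c`. -/
noncomputable def picardIterate (F : ℝ → V → V) (c : ℝ → V) (τ : ℝ) : ℕ → ℝ → V
  | 0 => c
  | n + 1 => fun t => c t + ∫ u in τ..t, F u (picardIterate F c τ n u)

theorem continuousOn_picardIterate [CompleteSpace V] {a b τ : ℝ} (hτ : τ ∈ Icc a b)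
    {F : ℝ → V → V} {c : ℝ → V}
    (hFc : ContinuousOn (fun q : ℝ × V => F q.1 q.2) (Icc a b ×ˢ univ))
    (hc : ContinuousOn c (Icc a b)) (n : ℕ) :
    ContinuousOn (picardIterate F c τ n) (Icc a b) := by
  induction n with
  | zero => exact hc
  | succ n ih =>
    refine hc.add ?_
    have h1 : ContinuousOn (fun u => F u (picardIterate F c τ n u)) (uIcc a b) := by
      rw [uIcc_of_le (hτ.1.trans hτ.2)]
      exact hFc.comp (continuousOn_id.prodMk ih) fun u hu => ⟨hu, mem_univ _⟩
    have h2 := intervalIntegral.continuousOn_primitive_interval' (μ := volume)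
      h1.intervalIntegrable (a := τ) (by rwa [uIcc_of_le (hτ.1.trans hτ.2)])
    rwa [uIcc_of_le (hτ.1.trans hτ.2)] at h2

/-- Picard iterates converge to any continuous solution of the Volterra equation. -/
theorem tendsto_picardIterate [CompleteSpace V] {a b τ K : ℝ} (hK : 0 ≤ K) (hτ : τ ∈ Icc a b)
    {F : ℝ → V → V} {c x : ℝ → V}
    (hFc : ContinuousOn (fun q : ℝ × V => F q.1 q.2) (Icc a b ×ˢ univ))
    (hF : ∀ t ∈ Icc a b, ∀ y z, ‖F t y - F t z‖ ≤ K * ‖y - z‖)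
    (hc : ContinuousOn c (Icc a b)) (hxc : ContinuousOn x (Icc a b))
    (hx : ∀ t ∈ Icc a b, x t = c t + ∫ u in τ..t, F u (x u)) {t : ℝ} (ht : t ∈ Icc a b) :
    Tendsto (fun n => picardIterate F c τ n t) atTop (𝓝 (x t)) := by
  obtain ⟨M, hM⟩ := isCompact_Icc.exists_bound_of_continuousOn (hxc.sub hc)
  have hint : ∀ z : ℝ → V, ContinuousOn z (Icc a b) → ∀ s ∈ Icc a b,
      IntervalIntegrable (fun u => F u (z u)) volume τ s := fun z hz s hs =>
    (hFc.comp (continuousOn_id.prodMk (hz.mono (uIcc_subset_Icc hτ hs)))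
      fun u hu => ⟨uIcc_subset_Icc hτ hs hu, mem_univ _⟩).intervalIntegrable
  have key := norm_le_pow_div_factorial_of_eq_integral hK hτ
    (fun n s => x s - picardIterate F c τ n s)
    (fun n s => F s (x s) - F s (picardIterate F c τ n s)) hM
    (fun n s hs => by
      rw [intervalIntegral.integral_sub (hint x hxc s hs)
        (hint _ (continuousOn_picardIterate hτ hFc hc n) s hs), hx s hs]
      simp only [picardIterate]
      abel)
    (fun n s hs => hF s hs _ _)
  have hlim : Tendsto (fun n : ℕ => M * ((K * |t - τ|) ^ n / n.factorial)) atTop (𝓝 (M * 0)) :=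
    (FloorSemiring.tendsto_pow_div_factorial_atTop _).const_mul M
  rw [mul_zero] at hlim
  have h2 := squeeze_zero_norm (fun n => key n t ht) hlim
  simpa using (tendsto_const_nhds (x := x t)).sub h2

/-- A Volterra equation with a continuous, globally Lipschitz kernel has a global solution. -/
theorem exists_volterra_solution [CompleteSpace V] {K : ℝ} (hK : 0 ≤ K) {F : ℝ → V → V}
    (hFc : Continuous fun q : ℝ × V => F q.1 q.2) (hF : ∀ t y z, ‖F t y - F t z‖ ≤ K * ‖y - z‖)
    {c : ℝ → V} (hc : Continuous c) (τ : ℝ) :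
    ∃ x : ℝ → V, Continuous x ∧ ∀ t, x t = c t + ∫ u in τ..t, F u (x u) := by
  set p := picardIterate F c τ with hp
  have hτ : ∀ R : ℝ, 0 ≤ R → τ ∈ Icc (τ - R) (τ + R) := fun R hR =>
    ⟨by linarith, by linarith⟩
  have hpc : ∀ n, Continuous (p n) := by
    intro n
    induction n with
    | zero => exact hc
    | succ n ih =>
      exact hc.add (intervalIntegral.continuous_primitive (fun _ _ =>
        (hFc.comp (continuous_id.prodMk ih)).intervalIntegrable _ _) τ)
  have hpi : ∀ n s, IntervalIntegrable (fun u => F u (p n u)) volume τ s := fun n s =>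
    (hFc.comp (continuous_id.prodMk (hpc n))).intervalIntegrable _ _
  -- The solution is the telescoping series of the differences of consecutive Picard iterates.
  have hunif : ∀ R : ℝ, 0 ≤ R → TendstoUniformlyOn (fun n t => p n t)
      (fun t => c t + ∑' n, (p (n + 1) t - p n t)) atTop (Icc (τ - R) (τ + R)) := by
    intro R hR
    obtain ⟨M, hM⟩ := (isCompact_Icc (a := τ - R) (b := τ + R)).exists_bound_of_continuousOn
      ((hpc 1).sub (hpc 0)).continuousOn
    have hM0 : 0 ≤ M := (norm_nonneg _).trans (hM τ (hτ R hR))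
    have key := norm_le_pow_div_factorial_of_eq_integral hK (hτ R hR)
      (fun n s => p (n + 1) s - p n s) (fun n s => F s (p (n + 1) s) - F s (p n s)) hM
      (fun n s _ => by
        rw [intervalIntegral.integral_sub (hpi _ s) (hpi _ s)]
        simp only [hp, picardIterate]
        abel)
      (fun n s _ => hF s _ _)
    have hsum : Summable fun n : ℕ => M * ((K * R) ^ n / n.factorial) :=
      (Real.summable_pow_div_factorial _).mul_left M
    have h1 := tendstoUniformlyOn_tsum_nat hsum (s := Icc (τ - R) (τ + R))
      (f := fun n s => p (n + 1) s - p n s) (fun n s hs => by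
        refine (key n s hs).trans ?_
        have : |s - τ| ≤ R := abs_le.2 ⟨by linarith [hs.1], by linarith [hs.2]⟩
        gcongr)
    rw [Metric.tendstoUniformlyOn_iff] at h1 ⊢
    intro ε hε
    filter_upwards [h1 ε hε] with n hn t ht
    have := hn t ht
    rw [Finset.sum_range_sub (fun n => p n t)] at this
    rw [dist_eq_norm] at this ⊢
    convert this using 2
    simp only [hp, picardIterate]
    abel
  refine ⟨fun t => c t + ∑' n, (p (n + 1) t - p n t), ?_, fun t => ?_⟩
  · rw [continuous_iff_continuousAt]
    intro t
    have h1 := (hunif (|t - τ| + 1) (by positivity)).continuousOn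
      (Frequently.of_forall fun n => (hpc n).continuousOn)
    refine h1.continuousAt (Icc_mem_nhds ?_ ?_)
    · linarith [neg_abs_le (t - τ)]
    · linarith [le_abs_self (t - τ)]
  · have hR := abs_nonneg (t - τ)
    have ht : t ∈ Icc (τ - |t - τ|) (τ + |t - τ|) :=
      ⟨by linarith [neg_abs_le (t - τ)], by linarith [le_abs_self (t - τ)]⟩
    have hcont := (hunif _ hR).continuousOn (Frequently.of_forall fun n => (hpc n).continuousOn)
    have hsub := uIcc_subset_Icc (hτ _ hR) ht
    have hxi : IntervalIntegrable
        (fun u => F u (c u + ∑' n, (p (n + 1) u - p n u))) volume τ t :=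
      ((hFc.comp_continuousOn (continuousOn_id.prodMk hcont)).mono hsub).intervalIntegrable
    refine tendsto_nhds_unique
      (((hunif _ hR).tendsto_at ht).comp (tendsto_add_atTop_nat 1)) ?_
    change Tendsto (fun n => c t + ∫ u in τ..t, F u (p n u)) atTop _
    refine tendsto_const_nhds.add ?_
    rw [Metric.tendsto_atTop']
    intro ε hε
    have hpos : 0 < ε / (K * |t - τ| + 1) := by positivity
    obtain ⟨N, hN⟩ := eventually_atTop.1
      ((Metric.tendstoUniformlyOn_iff.1 (hunif _ hR)) _ hpos)
    refine ⟨N, fun n hn => ?_⟩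
    rw [dist_eq_norm, ← intervalIntegral.integral_sub (hpi n t) hxi]
    have h2 : ‖∫ u in τ..t, (F u (p n u) - F u (c u + ∑' n, (p (n + 1) u - p n u)))‖
        ≤ (K * (ε / (K * |t - τ| + 1))) * |t - τ| := by
      refine intervalIntegral.norm_integral_le_of_norm_le_const fun u hu => ?_
      refine (hF u _ _).trans (mul_le_mul_of_nonneg_left ?_ hK)
      have := (hN n hn.le u (hsub (uIoc_subset_uIcc hu))).le
      rwa [dist_comm, dist_eq_norm] at this
    refine h2.trans_lt ?_
    have : K * (ε / (K * |t - τ| + 1)) * |t - τ|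
        = ε * ((K * |t - τ|) / (K * |t - τ| + 1)) := by ring
    rw [this]
    refine mul_lt_of_lt_one_right hε ?_
    rw [div_lt_one (by positivity)]
    linarith

end Volterra

/-! ### Flows driven by a continuous path -/

section PathFlow

variable {V : Type*} [NormedAddCommGroup V] [NormedSpace ℝ V]

/-- Grönwall's inequality in both time directions. -/
theorem norm_le_mul_exp_of_norm_deriv_le {z z' : ℝ → V} {K : ℝ}
    (hz : ∀ t, HasDerivAt z (z' t) t) (hz' : ∀ t, ‖z' t‖ ≤ K * ‖z t‖) (s t : ℝ) :
    ‖z t‖ ≤ ‖z s‖ * Real.exp (K * |t - s|) := by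
  have forward : ∀ (y y' : ℝ → V), (∀ t, HasDerivAt y (y' t) t) →
      (∀ t, ‖y' t‖ ≤ K * ‖y t‖) → ∀ s t : ℝ, s ≤ t →
      ‖y t‖ ≤ ‖y s‖ * Real.exp (K * (t - s)) := by
    intro y y' hy hy' s t hst
    have := norm_le_gronwallBound_of_norm_deriv_right_le (f := y) (f' := y') (δ := ‖y s‖)
      (K := K) (ε := 0) (a := s) (b := t) (fun u _ => (hy u).continuousAt.continuousWithinAt)
      (fun u _ => (hy u).hasDerivWithinAt) le_rfl (fun u _ => by simpa using hy' u) t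
      ⟨hst, le_rfl⟩
    rwa [gronwallBound_ε0] at this
  rcases le_total s t with h | h
  · rw [abs_of_nonneg (by linarith)]
    exact forward z z' hz hz' s t h
  · rw [abs_of_nonpos (by linarith)]
    have := forward (fun u => z (-u)) (fun u => -z' (-u))
      (fun u => by simpa [Function.comp_def] using (hz (-u)).scomp u (hasDerivAt_neg u))
      (fun u => by simpa using hz' (-u)) (-s) (-t) (by linarith)
    simpa [neg_add_eq_sub] using this

/-- `φ s t ξ` solves, as a function of `t ∈ ℝ` (both before and after `s`), the integral equation
`φ s t ξ = ξ + γ t - γ s + ∫_s^t F u (φ s u ξ) du` driven by the path `γ`. -/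
structure IsPathFlow (F : ℝ → V → V) (γ : ℝ → V) (φ : ℝ → ℝ → V → V) : Prop where
  continuous_time : ∀ s ξ, Continuous fun t => φ s t ξ
  equation : ∀ s t ξ, φ s t ξ = ξ + (γ t - γ s) + ∫ u in s..t, F u (φ s u ξ)

theorem exists_isPathFlow [CompleteSpace V] {K : ℝ} (hK : 0 ≤ K) {F : ℝ → V → V}
    (hFc : Continuous fun q : ℝ × V => F q.1 q.2) (hF : ∀ t y z, ‖F t y - F t z‖ ≤ K * ‖y - z‖)
    {γ : ℝ → V} (hγ : Continuous γ) : ∃ φ, IsPathFlow F γ φ := by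
  have := fun (s : ℝ) (ξ : V) => exists_volterra_solution hK hFc hF
    (c := fun t => ξ + (γ t - γ s)) (by fun_prop) s
  choose x hx hx' using this
  exact ⟨fun s t ξ => x s ξ t, hx, fun s t ξ => hx' s ξ t⟩

namespace IsPathFlow

variable {F : ℝ → V → V} {γ : ℝ → V} {φ : ℝ → ℝ → V → V} {K : ℝ}

theorem self (h : IsPathFlow F γ φ) (s : ℝ) (ξ : V) : φ s s ξ = ξ := by
  simpa using h.equation s s ξ

/-- A continuous solution of the integral equation on an interval is a trajectory of the flow. The
base time `r` of the equation may be any point of the interval. -/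
theorem eqOn_of_equation (h : IsPathFlow F γ φ) (hK : 0 ≤ K)
    (hFc : Continuous fun q : ℝ × V => F q.1 q.2) (hF : ∀ t y z, ‖F t y - F t z‖ ≤ K * ‖y - z‖)
    {a b r : ℝ} (hr : r ∈ Icc a b) {x : ℝ → V} (hxc : ContinuousOn x (Icc a b))
    (hx : ∀ t ∈ Icc a b, x t = x r + (γ t - γ r) + ∫ u in r..t, F u (x u)) :
    EqOn x (fun t => φ r t (x r)) (Icc a b) :=
  eqOn_of_eq_volterra hK hr hFc hF (c := fun t => x r + (γ t - γ r)) hxc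
    (h.continuous_time r (x r)).continuousOn hx (fun t _ => h.equation r t (x r))

/-- The integral equation may be restarted at any time. -/
theorem equation_restart (h : IsPathFlow F γ φ) (hFc : Continuous fun q : ℝ × V => F q.1 q.2)
    (s r t : ℝ) (ξ : V) :
    φ s t ξ = φ s r ξ + (γ t - γ r) + ∫ u in r..t, F u (φ s u ξ) := by
  have hc : Continuous fun u => F u (φ s u ξ) :=
    hFc.comp (continuous_id.prodMk (h.continuous_time s ξ))
  rw [h.equation s t ξ, h.equation s r ξ, ← intervalIntegral.integral_add_adjacent_intervals
    (hc.intervalIntegrable s r) (hc.intervalIntegrable r t)]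
  abel

theorem comp (h : IsPathFlow F γ φ) (hK : 0 ≤ K)
    (hFc : Continuous fun q : ℝ × V => F q.1 q.2) (hF : ∀ t y z, ‖F t y - F t z‖ ≤ K * ‖y - z‖)
    (s r t : ℝ) (ξ : V) : φ r t (φ s r ξ) = φ s t ξ :=
  (h.eqOn_of_equation hK hFc hF (a := min r t) (b := max r t) (r := r) (x := fun u => φ s u ξ)
    ⟨min_le_left _ _, le_max_left _ _⟩ (h.continuous_time s ξ).continuousOn
    (fun u _ => h.equation_restart hFc s r u ξ) ⟨min_le_right _ _, le_max_right _ _⟩).symm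

/-- The difference of two trajectories is differentiable in time: the driving path cancels. -/
theorem hasDerivAt_sub [CompleteSpace V] (h : IsPathFlow F γ φ)
    (hFc : Continuous fun q : ℝ × V => F q.1 q.2) (s r t : ℝ) (ξ η : V) :
    HasDerivAt (fun u => φ s u ξ - φ r u η) (F t (φ s t ξ) - F t (φ r t η)) t := by
  have hc : ∀ s ξ, Continuous fun u => F u (φ s u ξ) := fun s ξ =>
    hFc.comp (continuous_id.prodMk (h.continuous_time s ξ))
  have heq : (fun u => φ s u ξ - φ r u η) = fun u => (φ s t ξ - φ r t η)
      + ((∫ v in t..u, F v (φ s v ξ)) - ∫ v in t..u, F v (φ r v η)) := by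
    funext u
    rw [h.equation_restart hFc s t u ξ, h.equation_restart hFc r t u η]
    abel
  rw [heq]
  exact (((hc s ξ).integral_hasStrictDerivAt t t).hasDerivAt.sub
    ((hc r η).integral_hasStrictDerivAt t t).hasDerivAt).const_add _

theorem norm_sub_le [CompleteSpace V] (h : IsPathFlow F γ φ)
    (hFc : Continuous fun q : ℝ × V => F q.1 q.2) (hF : ∀ t y z, ‖F t y - F t z‖ ≤ K * ‖y - z‖)
    (s t : ℝ) (ξ η : V) : ‖φ s t ξ - φ s t η‖ ≤ ‖ξ - η‖ * Real.exp (K * |t - s|) := by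
  have := norm_le_mul_exp_of_norm_deriv_le (fun u => h.hasDerivAt_sub hFc s s u ξ η)
    (fun u => hF u _ _) s t
  simpa only [h.self] using this

/-- Joint continuity follows from the Lipschitz bound in the starting point, since
`φ s' t' ξ' = φ s t' (φ s' s ξ')` and `φ s' s (φ s s' ξ) = ξ`. -/
theorem continuous [CompleteSpace V] (h : IsPathFlow F γ φ) (hK : 0 ≤ K)
    (hFc : Continuous fun q : ℝ × V => F q.1 q.2)
    (hF : ∀ t y z, ‖F t y - F t z‖ ≤ K * ‖y - z‖) :
    Continuous fun q : ℝ × ℝ × V => φ q.1 q.2.1 q.2.2 := by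
  rw [continuous_iff_continuousAt]
  rintro ⟨s, t, ξ⟩
  have hback : Tendsto (fun q : ℝ × ℝ × V => φ q.1 s q.2.2) (𝓝 (s, t, ξ)) (𝓝 ξ) := by
    rw [tendsto_iff_norm_sub_tendsto_zero]
    have hlim : Tendsto (fun q : ℝ × ℝ × V =>
        ‖q.2.2 - φ s q.1 ξ‖ * Real.exp (K * |s - q.1|)) (𝓝 (s, t, ξ)) (𝓝 0) := by
      have hc : Continuous fun q : ℝ × ℝ × V =>
          ‖q.2.2 - φ s q.1 ξ‖ * Real.exp (K * |s - q.1|) := by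
        have h1 : Continuous fun q : ℝ × ℝ × V => φ s q.1 ξ :=
          (h.continuous_time s ξ).comp continuous_fst
        exact (continuous_snd.snd.sub h1).norm.mul (by fun_prop)
      simpa [h.self] using hc.tendsto (s, t, ξ)
    refine squeeze_zero (fun _ => norm_nonneg _) (fun q => ?_) hlim
    have := h.norm_sub_le hFc hF q.1 s q.2.2 (φ s q.1 ξ)
    rwa [h.comp hK hFc hF s q.1 s ξ, h.self] at this
  have hfix : Tendsto (fun q : ℝ × ℝ × V => φ s q.2.1 ξ) (𝓝 (s, t, ξ)) (𝓝 (φ s t ξ)) :=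
    ((h.continuous_time s ξ).comp (continuous_fst.comp continuous_snd)).tendsto (s, t, ξ)
  have hdiff : Tendsto (fun q : ℝ × ℝ × V => φ q.1 q.2.1 q.2.2 - φ s q.2.1 ξ)
      (𝓝 (s, t, ξ)) (𝓝 0) := by
    have hlim : Tendsto (fun q : ℝ × ℝ × V =>
        ‖φ q.1 s q.2.2 - ξ‖ * Real.exp (K * |q.2.1 - s|)) (𝓝 (s, t, ξ)) (𝓝 0) := by
      have h1 : Tendsto (fun q : ℝ × ℝ × V => ‖φ q.1 s q.2.2 - ξ‖) (𝓝 (s, t, ξ)) (𝓝 0) :=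
        (tendsto_iff_norm_sub_tendsto_zero).1 hback
      have h2 : Continuous fun q : ℝ × ℝ × V => Real.exp (K * |q.2.1 - s|) := by fun_prop
      simpa using h1.mul (h2.tendsto (s, t, ξ))
    refine squeeze_zero_norm (fun q => ?_) hlim
    have := h.norm_sub_le hFc hF s q.2.1 (φ q.1 s q.2.2) ξ
    rwa [h.comp hK hFc hF] at this
  have := hdiff.add hfix
  simpa [ContinuousAt] using this

end IsPathFlow

end PathFlow

/-! ### Regularity of the drift -/

namespace IsCbInfOne

variable {d : ℕ} {f : E d → ℝ → E d}

theorem differentiable (hf : IsCbInfOne f) (t : ℝ) : Differentiable ℝ fun x => f x t :=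
  (hf.smooth_space t).differentiable (by simp)

theorem exists_norm_fderiv_le (hf : IsCbInfOne f) :
    ∃ K, 0 ≤ K ∧ ∀ x t, ‖fderiv ℝ (fun y => f y t) x‖ ≤ K := by
  obtain ⟨C, hC⟩ := hf.bounded_space 1 le_rfl
  refine ⟨max C 0, le_max_right _ _, fun x t => ?_⟩
  rw [← norm_iteratedFDeriv_one]
  exact (hC x t).trans (le_max_left _ _)

theorem exists_norm_sub_le (hf : IsCbInfOne f) :
    ∃ K, 0 ≤ K ∧ ∀ t x y, ‖f x t - f y t‖ ≤ K * ‖x - y‖ := by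
  obtain ⟨K, hK, h⟩ := hf.exists_norm_fderiv_le
  exact ⟨K, hK, fun t x y => convex_univ.norm_image_sub_le_of_norm_fderiv_le
    (fun z _ => hf.differentiable t z) (fun z _ => h z t) (mem_univ y) (mem_univ x)⟩

theorem exists_norm_time_sub_le (hf : IsCbInfOne f) :
    ∃ C, 0 ≤ C ∧ ∀ x s t, ‖f x t - f x s‖ ≤ C * |t - s| := by
  obtain ⟨C, hC⟩ := hf.bounded_time
  refine ⟨max C 0, le_max_right _ _, fun x s t => ?_⟩
  exact convex_univ.norm_image_sub_le_of_norm_deriv_le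
    (fun z _ => (hf.contDiff_time x).differentiable (by simp) z)
    (fun z _ => (hC x z).trans (le_max_left _ _)) (mem_univ s) (mem_univ t)

theorem continuous (hf : IsCbInfOne f) : Continuous fun q : ℝ × E d => f q.2 q.1 := by
  obtain ⟨K, hK, hx⟩ := hf.exists_norm_sub_le
  obtain ⟨C, hC, ht⟩ := hf.exists_norm_time_sub_le
  rw [continuous_iff_continuousAt]
  rintro ⟨s, y⟩
  rw [ContinuousAt, tendsto_iff_norm_sub_tendsto_zero]
  have hlim : Tendsto (fun q : ℝ × E d => K * ‖q.2 - y‖ + C * |q.1 - s|) (𝓝 (s, y)) (𝓝 0) := by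
    have hc : Continuous fun q : ℝ × E d => K * ‖q.2 - y‖ + C * |q.1 - s| := by fun_prop
    simpa using hc.tendsto (s, y)
  refine squeeze_zero (fun _ => norm_nonneg _) (fun q => ?_) hlim
  calc ‖f q.2 q.1 - f y s‖ ≤ ‖f q.2 q.1 - f y q.1‖ + ‖f y q.1 - f y s‖ :=
        norm_sub_le_norm_sub_add_norm_sub _ _ _
    _ ≤ _ := add_le_add (hx _ _ _) (ht _ _ _)

theorem exists_norm_fderiv_sub_le (hf : IsCbInfOne f) :
    ∃ C, 0 ≤ C ∧ ∀ t x y,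
      ‖fderiv ℝ (fun z => f z t) x - fderiv ℝ (fun z => f z t) y‖ ≤ C * ‖x - y‖ := by
  obtain ⟨C, hC⟩ := hf.bounded_space 2 (by norm_num)
  refine ⟨max C 0, le_max_right _ _, fun t x y => ?_⟩
  refine convex_univ.norm_image_sub_le_of_norm_fderiv_le (𝕜 := ℝ)
    (fun z _ => ((hf.smooth_space t).fderiv_right (m := 1) (by norm_cast)).differentiable
      (by simp) z) (fun z _ => ?_) (mem_univ y) (mem_univ x)
  rw [← norm_iteratedFDeriv_one, norm_iteratedFDeriv_fderiv]
  exact (hC z t).trans (le_max_left _ _)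

theorem exists_norm_taylor_le (hf : IsCbInfOne f) :
    ∃ C, 0 ≤ C ∧ ∀ t x y,
      ‖f y t - f x t - fderiv ℝ (fun z => f z t) x (y - x)‖ ≤ C * ‖y - x‖ ^ 2 := by
  obtain ⟨C, hC, h⟩ := hf.exists_norm_fderiv_sub_le
  refine ⟨C, hC, fun t x y => ?_⟩
  have := (convex_closedBall x ‖y - x‖).norm_image_sub_le_of_norm_fderiv_le'
    (f := fun z => f z t) (φ := fderiv ℝ (fun z => f z t) x) (C := C * ‖y - x‖)
    (fun z _ => hf.differentiable t z) (fun z hz => (h t z x).trans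
      (mul_le_mul_of_nonneg_left (mem_closedBall_iff_norm.1 hz) hC))
    (Metric.mem_closedBall_self (norm_nonneg _)) (mem_closedBall_iff_norm.2 le_rfl)
  rwa [mul_assoc, ← pow_two] at this

/-- The space derivative is only assumed continuous in `x`; its continuity in `t` is obtained by
interpolating between the Lipschitz bound of `f` in time and the bound on the second space
derivative, which gives a Hölder exponent `1/2`. -/
theorem exists_norm_fderiv_time_sub_le (hf : IsCbInfOne f) :
    ∃ C, 0 ≤ C ∧ ∀ x s t,
      ‖fderiv ℝ (fun z => f z t) x - fderiv ℝ (fun z => f z s) x‖ ≤ C * √|t - s| := by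
  obtain ⟨A, hA, hAx⟩ := hf.exists_norm_taylor_le
  obtain ⟨B, hB, hBt⟩ := hf.exists_norm_time_sub_le
  refine ⟨2 * A + 2 * B, by positivity, fun x s t => ?_⟩
  rcases eq_or_ne t s with rfl | hne
  · simp
  -- A space increment of length `√|t - s|` balances the two error terms.
  set r := √|t - s| with hr
  have hr0 : 0 < r := Real.sqrt_pos.2 (abs_pos.2 (sub_ne_zero.2 hne))
  have hrr : |t - s| = r ^ 2 := (Real.sq_sqrt (abs_nonneg _)).symm
  refine ContinuousLinearMap.opNorm_le_of_unit_norm (by positivity) fun v hv => ?_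
  have hnorm : ‖r • v‖ = r := by rw [norm_smul, hv, mul_one, Real.norm_of_nonneg hr0.le]
  have h1 := hAx t x (x + r • v)
  have h2 := hAx s x (x + r • v)
  have h3 := hBt (x + r • v) s t
  have h4 := hBt x s t
  rw [add_sub_cancel_left, hnorm] at h1 h2
  rw [hrr] at h3 h4
  set Dt := fderiv ℝ (fun z => f z t) x
  set Ds := fderiv ℝ (fun z => f z s) x
  have hsplit : r • (Dt - Ds) v = -(f (x + r • v) t - f x t - Dt (r • v))
      + (f (x + r • v) s - f x s - Ds (r • v))
      + ((f (x + r • v) t - f (x + r • v) s) - (f x t - f x s)) := by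
    simp only [map_smul, sub_apply, smul_sub]
    abel
  have hbound : r * ‖(Dt - Ds) v‖ ≤ r * ((2 * A + 2 * B) * r) := by
    calc r * ‖(Dt - Ds) v‖ = ‖r • (Dt - Ds) v‖ := by
          rw [norm_smul, Real.norm_of_nonneg hr0.le]
      _ ≤ A * r ^ 2 + A * r ^ 2 + (B * r ^ 2 + B * r ^ 2) := by
          rw [hsplit]
          refine (norm_add_le _ _).trans (add_le_add ((norm_add_le _ _).trans
            (add_le_add ?_ h2)) ((norm_sub_le _ _).trans (add_le_add h3 h4)))
          rwa [norm_neg]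
      _ = r * ((2 * A + 2 * B) * r) := by ring
  exact le_of_mul_le_mul_left hbound hr0

theorem continuous_fderiv (hf : IsCbInfOne f) :
    Continuous fun q : ℝ × E d => fderiv ℝ (fun y => f y q.1) q.2 := by
  obtain ⟨K, hK, hx⟩ := hf.exists_norm_fderiv_sub_le
  obtain ⟨C, hC, ht⟩ := hf.exists_norm_fderiv_time_sub_le
  rw [continuous_iff_continuousAt]
  rintro ⟨s, y⟩
  rw [ContinuousAt, tendsto_iff_norm_sub_tendsto_zero]
  have hlim : Tendsto (fun q : ℝ × E d => K * ‖q.2 - y‖ + C * √|q.1 - s|)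
      (𝓝 (s, y)) (𝓝 0) := by
    have hc : Continuous fun q : ℝ × E d => K * ‖q.2 - y‖ + C * √|q.1 - s| := by fun_prop
    simpa using hc.tendsto (s, y)
  refine squeeze_zero (fun _ => norm_nonneg _) (fun q => ?_) hlim
  exact (norm_sub_le_norm_sub_add_norm_sub _ _ _).trans (add_le_add (hx q.1 q.2 y) (ht y s q.1))

end IsCbInfOne

/-! ### The derivative of the flow in its starting point -/

/-- Along a trajectory `X u = φ r u ξ` of the flow, the derivative of `φ t T` at `X t` is the
solution `R t` of the backward linear equation `R' = -R J`, `R T = 1`, where `J` is the space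
derivative of the drift along `X`. For a second trajectory at distance `z` from `X`, the product
`R z` has derivative `R (z' - J z) = O(‖z‖²)`, so that `z T = R T z T` differs from `R t z t` by
`O(‖z t‖²)`. -/
theorem IsPathFlow.exists_hasFDerivAt {d : ℕ} {f : E d → ℝ → E d} (hf : IsCbInfOne f)
    {γ : ℝ → E d} {φ : ℝ → ℝ → E d → E d} (h : IsPathFlow (fun t x => f x t) γ φ)
    (r T : ℝ) (ξ : E d) :
    ∃ R : ℝ → E d →L[ℝ] E d, R T = ContinuousLinearMap.id ℝ (E d) ∧
      (∀ t, HasDerivAt R (-((R t).comp (fderiv ℝ (fun y => f y t) (φ r t ξ)))) t) ∧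
      ∀ t, HasFDerivAt (φ t T) (R t) (φ r t ξ) := by
  obtain ⟨K, hK, hJK⟩ := hf.exists_norm_fderiv_le
  obtain ⟨K', hK', hF⟩ := hf.exists_norm_sub_le
  obtain ⟨C, hC, htaylor⟩ := hf.exists_norm_taylor_le
  have hFc := hf.continuous
  set J : ℝ → E d →L[ℝ] E d := fun t => fderiv ℝ (fun y => f y t) (φ r t ξ) with hJ
  have hJc : Continuous J :=
    hf.continuous_fderiv.comp (continuous_id.prodMk (h.continuous_time r ξ))
  have hGc : Continuous fun q : ℝ × (E d →L[ℝ] E d) => -(q.2.comp (J q.1)) := by fun_prop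
  obtain ⟨R, hRc, hR⟩ := exists_volterra_solution (V := E d →L[ℝ] E d) hK
    (F := fun t A => -(A.comp (J t))) hGc
    (fun t A B => by
      rw [neg_sub_neg, norm_sub_rev, ← ContinuousLinearMap.sub_comp, mul_comm]
      exact (ContinuousLinearMap.opNorm_comp_le _ _).trans
        (mul_le_mul_of_nonneg_left (hJK _ _) (norm_nonneg _)))
    (continuous_const (y := ContinuousLinearMap.id ℝ (E d))) T
  have hRd : ∀ t, HasDerivAt R (-((R t).comp (J t))) t := by
    intro t
    have hc : Continuous fun u => -((R u).comp (J u)) := hGc.comp (continuous_id.prodMk hRc)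
    have := (hc.integral_hasStrictDerivAt T t).hasDerivAt.const_add
      (ContinuousLinearMap.id ℝ (E d))
    exact this.congr_of_eventuallyEq (Eventually.of_forall hR)
  refine ⟨R, by simpa using hR T, hRd, fun t => ?_⟩
  obtain ⟨B, hB⟩ := (isCompact_uIcc (a := t) (b := T)).exists_bound_of_continuousOn
    hRc.continuousOn
  have hB0 : 0 ≤ B := (norm_nonneg _).trans (hB t left_mem_uIcc)
  -- Grönwall's constant: `‖z u‖ ≤ ‖z t‖ * e` for `u` between `t` and `T`.
  set e := Real.exp (K' * |T - t|) with he
  have hmain : ∀ η : E d, ‖φ t T (φ r t ξ + η) - φ t T (φ r t ξ) - R t η‖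
      ≤ B * (C * e ^ 2) * |T - t| * ‖η‖ ^ 2 := by
    intro η
    set z : ℝ → E d := fun u => φ t u (φ r t ξ + η) - φ r u ξ with hz
    have hzd : ∀ u, HasDerivAt z (f (φ t u (φ r t ξ + η)) u - f (φ r u ξ) u) u := fun u =>
      h.hasDerivAt_sub hFc t r u _ _
    have hzt : z t = η := by simp [hz, h.self]
    have hzb : ∀ u ∈ uIcc t T, ‖z u‖ ≤ ‖η‖ * e := by
      intro u hu
      have h1 := norm_le_mul_exp_of_norm_deriv_le hzd (fun u => hF u _ _) t u
      rw [hzt] at h1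
      refine h1.trans (mul_le_mul_of_nonneg_left (Real.exp_le_exp.2
        (mul_le_mul_of_nonneg_left ?_ hK')) (norm_nonneg _))
      exact abs_sub_left_of_mem_uIcc hu
    have hprod : ∀ u, HasDerivAt (fun u => R u (z u))
        (R u (f (φ t u (φ r t ξ + η)) u - f (φ r u ξ) u - J u (z u))) u := by
      intro u
      refine ((hRd u).clm_apply (hzd u)).congr_deriv ?_
      simp only [neg_apply, ContinuousLinearMap.comp_apply, map_sub]
      abel
    have hmv := (convex_uIcc t T).norm_image_sub_le_of_norm_hasDerivWithin_le
      (f := fun u => R u (z u)) (C := B * (C * e ^ 2 * ‖η‖ ^ 2))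
      (fun u _ => (hprod u).hasDerivWithinAt)
      (fun u hu => by
        refine (ContinuousLinearMap.le_opNorm _ _).trans (mul_le_mul (hB u hu) ?_
          (norm_nonneg _) hB0)
        refine (htaylor u (φ r u ξ) (φ t u (φ r t ξ + η))).trans ?_
        have := pow_le_pow_left₀ (norm_nonneg _) (hzb u hu) 2
        calc C * ‖z u‖ ^ 2 ≤ C * (‖η‖ * e) ^ 2 := mul_le_mul_of_nonneg_left this hC
          _ = C * e ^ 2 * ‖η‖ ^ 2 := by ring)
      left_mem_uIcc right_mem_uIcc
    have hRT : R T = ContinuousLinearMap.id ℝ (E d) := by simpa using hR T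
    simp only [hRT, hzt, ContinuousLinearMap.id_apply] at hmv
    rw [h.comp hK' hFc hF r t T ξ]
    refine hmv.trans (le_of_eq ?_)
    rw [Real.norm_eq_abs]
    ring
  rw [hasFDerivAt_iff_isLittleO_nhds_zero]
  refine (Asymptotics.IsBigO.of_bound (B * (C * e ^ 2) * |T - t|)
    (g := fun η : E d => ‖η‖ ^ 2) (Eventually.of_forall fun η => ?_)).trans_isLittleO ?_
  · simpa using hmain η
  · exact Asymptotics.isLittleO_norm_pow_id one_lt_two

/-! ### Riemann sums over partitions -/

namespace Partition

variable {s t : ℝ}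

theorem le (p : Partition s t) : s ≤ t := by
  have := p.strictMono.monotone (Fin.zero_le (Fin.last p.N))
  rwa [p.first, p.last] at this

theorem pt_mem (p : Partition s t) (k : Fin (p.N + 1)) : p.pt k ∈ Icc s t := by
  have h1 := p.strictMono.monotone (Fin.zero_le k)
  have h2 := p.strictMono.monotone (Fin.le_last k)
  rw [p.first] at h1
  rw [p.last] at h2
  exact ⟨h1, h2⟩

theorem pt_castSucc_le (p : Partition s t) (k : Fin p.N) : p.pt k.castSucc ≤ p.pt k.succ :=
  p.strictMono.monotone (Fin.castSucc_lt_succ (i := k)).le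

theorem sub_le_mesh (p : Partition s t) (k : Fin p.N) : p.pt k.succ - p.pt k.castSucc ≤ p.mesh :=
  le_ciSup (f := fun k : Fin p.N => p.pt k.succ - p.pt k.castSucc)
    (Set.finite_range _).bddAbove k

theorem sum_sub {V : Type*} [AddCommGroup V] (p : Partition s t) (h : ℝ → V) :
    ∑ k : Fin p.N, (h (p.pt k.succ) - h (p.pt k.castSucc)) = h t - h s := by
  have telescope : ∀ (n : ℕ) (q : Fin (n + 1) → V),
      ∑ k : Fin n, (q k.succ - q k.castSucc) = q (Fin.last n) - q 0 := by
    intro n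
    induction n with
    | zero => intro q; simp
    | succ n ih =>
      intro q
      rw [Fin.sum_univ_castSucc]
      have := ih fun k => q k.castSucc
      simp only [Fin.succ_castSucc, Fin.castSucc_zero, Fin.succ_last] at this ⊢
      rw [this]
      abel
  have := telescope p.N fun k => h (p.pt k)
  rwa [p.first, p.last] at this

/-- There are partitions of arbitrarily small mesh; for `s = t` the only one has no intervals. -/
theorem exists_seq_tendsto_mesh (hst : s ≤ t) :
    ∃ p : ℕ → Partition s t, Tendsto p atTop (comap mesh (𝓝 0)) := by
  rcases hst.eq_or_lt with rfl | hst
  · refine ⟨fun _ => ⟨0, fun _ => s, fun a b h => absurd h (by omega),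
      rfl, rfl⟩, tendsto_comap_iff.2 ?_⟩
    have : ∀ q : Partition s s, q.N = 0 → q.mesh = 0 := by
      intro q hq
      have : IsEmpty (Fin q.N) := by rw [hq]; infer_instance
      exact Real.iSup_of_isEmpty _
    exact tendsto_const_nhds.congr fun n => (this _ rfl).symm
  · have hpos : ∀ n : ℕ, 0 < (t - s) / (n + 1) := fun n => by
      have := sub_pos.2 hst
      positivity
    refine ⟨fun n => ⟨n + 1, fun k => s + k * ((t - s) / (n + 1)), fun a b hab => ?_,
      by simp, ?_⟩, tendsto_comap_iff.2 ?_⟩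
    · have : (a : ℝ) < b := by exact_mod_cast hab
      have := mul_lt_mul_of_pos_right this (hpos n)
      simpa using this
    · simp only [Fin.val_last, Nat.cast_add, Nat.cast_one]
      field_simp
      ring
    · have hlim : Tendsto (fun n : ℕ => (t - s) / ((n : ℝ) + 1)) atTop (𝓝 0) := by
        have := (tendsto_one_div_add_atTop_nhds_zero_nat (𝕜 := ℝ)).const_mul (t - s)
        simpa only [mul_one_div, mul_zero] using this
      refine hlim.congr fun n => ?_
      simp only [Function.comp, mesh, Fin.val_succ, Fin.val_castSucc, Nat.cast_add, Nat.cast_one]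
      have : ∀ k : Fin (n + 1), s + ((k : ℝ) + 1) * ((t - s) / (n + 1))
          - (s + (k : ℝ) * ((t - s) / (n + 1))) = (t - s) / (n + 1) := fun k => by ring
      simp_rw [this]
      exact (ciSup_const).symm

/-- Riemann sums for `∫_s^t B u (w u) du` in which `w` is replaced, on each interval of the
partition, by the mean of its values at the two endpoints. -/
theorem tendsto_sum_integral {V W : Type*} [NormedAddCommGroup V] [NormedSpace ℝ V]
    [NormedAddCommGroup W] [NormedSpace ℝ W] {B : ℝ → V →L[ℝ] W} (hB : Continuous B) {w : ℝ → V}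
    (hw : ContinuousOn w (Icc s t)) :
    Tendsto (fun p : Partition s t => ∑ k : Fin p.N, ∫ u in p.pt k.castSucc..p.pt k.succ,
        B u ((1 / 2 : ℝ) • (w (p.pt k.succ) + w (p.pt k.castSucc))))
      (comap mesh (𝓝 0)) (𝓝 (∫ u in s..t, B u (w u))) := by
  rcases lt_or_ge t s with hts | hst
  · have : IsEmpty (Partition s t) := ⟨fun p => absurd p.le (not_le.2 hts)⟩
    rw [Filter.filter_eq_bot_of_isEmpty (comap mesh (𝓝 0) : Filter (Partition s t))]
    exact tendsto_bot
  obtain ⟨M, hM⟩ := (isCompact_Icc (a := s) (b := t)).exists_bound_of_continuousOn hB.continuousOn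
  have hM0 : 0 ≤ M := (norm_nonneg _).trans (hM s ⟨le_rfl, hst⟩)
  have hts : 0 ≤ t - s := sub_nonneg.2 hst
  have hint : ∀ a ∈ Icc s t, ∀ b ∈ Icc s t,
      IntervalIntegrable (fun u => B u (w u)) volume a b := fun a ha b hb =>
    (hB.continuousOn.clm_apply (hw.mono (uIcc_subset_Icc ha hb))).intervalIntegrable
  rw [Metric.tendsto_nhds]
  intro ε hε
  set η := ε / (M * (t - s) + 1) with hη
  have hη0 : 0 < η := by positivity
  obtain ⟨δ, hδ, hδw⟩ := Metric.uniformContinuousOn_iff.1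
    (isCompact_Icc.uniformContinuousOn_of_continuous hw) η hη0
  filter_upwards [preimage_mem_comap (Iio_mem_nhds hδ)] with p hp
  have hmesh : p.mesh < δ := hp
  have hsplit : ∫ u in s..t, B u (w u)
      = ∑ k : Fin p.N, ∫ u in p.pt k.castSucc..p.pt k.succ, B u (w u) := by
    have h0 : s ∈ Icc s t := ⟨le_rfl, hst⟩
    have := p.sum_sub fun v => ∫ u in s..v, B u (w u)
    rw [intervalIntegral.integral_same, sub_zero] at this
    rw [← this]
    refine Finset.sum_congr rfl fun k _ => ?_
    exact intervalIntegral.integral_interval_sub_left (hint _ h0 _ (p.pt_mem _))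
      (hint _ h0 _ (p.pt_mem _))
  have hterm : ∀ k : Fin p.N,
      ‖(∫ u in p.pt k.castSucc..p.pt k.succ,
          B u ((1 / 2 : ℝ) • (w (p.pt k.succ) + w (p.pt k.castSucc))))
        - ∫ u in p.pt k.castSucc..p.pt k.succ, B u (w u)‖
      ≤ M * η * (p.pt k.succ - p.pt k.castSucc) := by
    intro k
    have hk := p.pt_castSucc_le k
    have hc : Continuous fun u =>
        B u ((1 / 2 : ℝ) • (w (p.pt k.succ) + w (p.pt k.castSucc))) := by fun_prop
    rw [← intervalIntegral.integral_sub (hc.intervalIntegrable _ _)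
      (hint _ (p.pt_mem _) _ (p.pt_mem _))]
    have hbound := intervalIntegral.norm_integral_le_of_norm_le_const
      (a := p.pt k.castSucc) (b := p.pt k.succ) (C := M * η)
      (f := fun u => B u ((1 / 2 : ℝ) • (w (p.pt k.succ) + w (p.pt k.castSucc))) - B u (w u))
      (fun u hu => by
        rw [uIoc_of_le hk] at hu
        have hus : u ∈ Icc s t :=
          ⟨(p.pt_mem k.castSucc).1.trans hu.1.le, hu.2.trans (p.pt_mem k.succ).2⟩
        have hlen := p.sub_le_mesh k
        have h1 : ‖w (p.pt k.succ) - w u‖ ≤ η := by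
          rw [← dist_eq_norm]
          refine (hδw _ (p.pt_mem _) _ hus ?_).le
          rw [Real.dist_eq, abs_of_nonneg (by linarith [hu.2])]
          linarith [hu.1]
        have h2 : ‖w (p.pt k.castSucc) - w u‖ ≤ η := by
          rw [← dist_eq_norm]
          refine (hδw _ (p.pt_mem _) _ hus ?_).le
          rw [Real.dist_eq, abs_of_nonpos (by linarith [hu.1])]
          linarith [hu.2]
        rw [← map_sub]
        refine ((B u).le_opNorm _).trans (mul_le_mul (hM u hus) ?_ (norm_nonneg _) hM0)
        have heq : (1 / 2 : ℝ) • (w (p.pt k.succ) + w (p.pt k.castSucc)) - w u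
            = (1 / 2 : ℝ) • ((w (p.pt k.succ) - w u) + (w (p.pt k.castSucc) - w u)) := by
          module
        rw [heq, norm_smul, Real.norm_of_nonneg (by norm_num)]
        have := (norm_add_le (w (p.pt k.succ) - w u) (w (p.pt k.castSucc) - w u)).trans
          (add_le_add h1 h2)
        linarith)
    rwa [abs_of_nonneg (sub_nonneg.2 hk)] at hbound
  rw [dist_eq_norm, hsplit, ← Finset.sum_sub_distrib]
  calc _ ≤ ∑ k : Fin p.N, M * η * (p.pt k.succ - p.pt k.castSucc) :=
        norm_sum_le_of_le _ fun k _ => hterm k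
    _ = M * η * (t - s) := by rw [← Finset.mul_sum, p.sum_sub fun v => v]
    _ = ε * ((M * (t - s)) / (M * (t - s) + 1)) := by rw [hη]; ring
    _ < ε := by
        refine mul_lt_of_lt_one_right hε ?_
        rw [div_lt_one (by positivity)]
        linarith

end Partition

/-! ### The Stratonovich integral of a deterministic integrand -/

section Stratonovich

variable {Ω : Type*} {d m : ℕ} {g : ℝ → E m →L[ℝ] E d}

/-- The Stratonovich integral of a `C¹` integrand converges path by path: summation by parts is
exact for the symmetric Riemann sums, and leaves Riemann sums of the integral of `w` against
`g'`. -/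
theorem tendsto_stratonovichSum (hg : IsCbOne g) {w : ℝ → Ω → E m} {s t : ℝ} {ω : Ω}
    (hw : ContinuousOn (fun u => w u ω) (Icc s t)) :
    Tendsto (fun p : Partition s t => stratonovichSum w (fun u _ => g u) p ω)
      (comap Partition.mesh (𝓝 0))
      (𝓝 (g t (w t ω) - g s (w s ω) - ∫ u in s..t, deriv g u (w u ω))) := by
  have hg' : Continuous (deriv g) := hg.contDiff.continuous_deriv le_rfl
  refine (tendsto_const_nhds.sub (Partition.tendsto_sum_integral hg' hw)).congr fun p => ?_
  have hsum := p.sum_sub fun u => g u (w u ω)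
  rw [← hsum, stratonovichSum, ← Finset.sum_sub_distrib]
  refine Finset.sum_congr rfl fun k _ => ?_
  set a := p.pt k.castSucc
  set b := p.pt k.succ
  have hint : ∫ u in a..b, deriv g u ((1 / 2 : ℝ) • (w b ω + w a ω))
      = g b ((1 / 2 : ℝ) • (w b ω + w a ω)) - g a ((1 / 2 : ℝ) • (w b ω + w a ω)) := by
    refine intervalIntegral.integral_eq_sub_of_hasDerivAt
      (f := fun u => g u ((1 / 2 : ℝ) • (w b ω + w a ω))) (fun u _ => ?_)
      (Continuous.intervalIntegrable (by fun_prop) _ _)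
    have := ((hg.contDiff.differentiable (by simp)) u).hasDerivAt.clm_apply
      (hasDerivAt_const u ((1 / 2 : ℝ) • (w b ω + w a ω)))
    simpa using this
  rw [hint]
  simp only [map_smul, map_add, map_sub, smul_apply, add_apply]
  module

/-- The primitive `t ↦ g t (w t) - ∫_0^t g' u (w u) du` of the Stratonovich integral of `g` along a
path `w` on `[0, T]`. The path is extended by constants outside `[0, T]`, so that the primitive is
defined, and continuous, on the whole line. -/
noncomputable def noisePath (g : ℝ → E m →L[ℝ] E d) (T : ℝ) (w : ℝ → E m) (t : ℝ) : E d :=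
  g t (w (max 0 (min T t))) - ∫ u in (0 : ℝ)..t, deriv g u (w (max 0 (min T u)))

variable {T : ℝ}

theorem continuous_clamp (hT : 0 ≤ T) {w : ℝ → E m} (hw : ContinuousOn w (Icc 0 T)) :
    Continuous fun t => w (max 0 (min T t)) :=
  hw.comp_continuous (by fun_prop) fun _ => ⟨le_max_left _ _, max_le hT (min_le_left _ _)⟩

theorem continuous_noisePath (hg : IsCbOne g) (hT : 0 ≤ T) {w : ℝ → E m}
    (hw : ContinuousOn w (Icc 0 T)) : Continuous (noisePath g T w) := by
  have hg' : Continuous (deriv g) := hg.contDiff.continuous_deriv le_rfl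
  have hc := continuous_clamp hT hw
  exact (hg.contDiff.continuous.clm_apply hc).sub
    (intervalIntegral.continuous_primitive
      (fun _ _ => (hg'.clm_apply hc).intervalIntegrable _ _) 0)

theorem noisePath_sub (hg : IsCbOne g) {w : ℝ → E m} (hw : ContinuousOn w (Icc 0 T)) {s t : ℝ}
    (hs : s ∈ Icc 0 T) (ht : t ∈ Icc 0 T) :
    noisePath g T w t - noisePath g T w s
      = g t (w t) - g s (w s) - ∫ u in s..t, deriv g u (w u) := by
  have hT : 0 ≤ T := hs.1.trans hs.2
  have hg' : Continuous (deriv g) := hg.contDiff.continuous_deriv le_rfl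
  have hc : Continuous fun u => deriv g u (w (max 0 (min T u))) :=
    hg'.clm_apply (continuous_clamp hT hw)
  have hclamp : ∀ u ∈ Icc 0 T, max 0 (min T u) = u := fun u hu => by
    rw [min_eq_right hu.2, max_eq_right hu.1]
  have h1 : ∫ u in s..t, deriv g u (w u) = ∫ u in s..t, deriv g u (w (max 0 (min T u))) :=
    intervalIntegral.integral_congr fun u hu => by
      simp only [hclamp u (uIcc_subset_Icc hs ht hu)]
  rw [h1, ← intervalIntegral.integral_interval_sub_left (hc.intervalIntegrable 0 t)
    (hc.intervalIntegrable 0 s), noisePath, noisePath, hclamp s hs, hclamp t ht]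
  abel

theorem stronglyMeasurable_stratonovichSum {m₀ : MeasurableSpace Ω} {w : ℝ → Ω → E m} {s t : ℝ}
    (hw : ∀ u v, s ≤ u → u ≤ v → v ≤ t → StronglyMeasurable[m₀] fun ω => w v ω - w u ω)
    (p : Partition s t) :
    StronglyMeasurable[m₀] (stratonovichSum w (fun u _ => g u) p) := by
  unfold stratonovichSum
  refine Finset.stronglyMeasurable_fun_sum _ fun k _ => ?_
  exact (ContinuousLinearMap.continuous _).comp_stronglyMeasurable
    (hw _ _ (p.pt_mem _).1 (p.pt_castSucc_le k) (p.pt_mem _).2)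

variable {mΩ : MeasurableSpace Ω} {P : Measure Ω} {𝓕 : Filtration ℝ mΩ} {w : ℝ → Ω → E m}

theorem IsWienerProcess.stronglyMeasurable (hw : IsWienerProcess P 𝓕 T w) {t : ℝ}
    (ht : t ∈ Icc 0 T) : StronglyMeasurable (w t) :=
  ((hw.adapted t ht).mono (𝓕.le t) le_rfl).stronglyMeasurable

/-- The Stratonovich integral of a deterministic `C¹` integrand is the increment of the noise path,
and is determined up to a null set. -/
theorem IsWienerProcess.isStratonovichIntegral_iff [IsProbabilityMeasure P]
    (hw : IsWienerProcess P 𝓕 T w) (hg : IsCbOne g) {s t : ℝ} (hs : 0 ≤ s) (hst : s ≤ t)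
    (ht : t ≤ T) (I : Ω → E d) :
    IsStratonovichIntegral P w (fun u _ => g u) s t I ↔
      ∀ᵐ ω ∂P, I ω = noisePath g T (fun u => w u ω) t - noisePath g T (fun u => w u ω) s := by
  have hae : ∀ᵐ ω ∂P, Tendsto (fun p : Partition s t => stratonovichSum w (fun u _ => g u) p ω)
      (comap Partition.mesh (𝓝 0))
      (𝓝 (noisePath g T (fun u => w u ω) t - noisePath g T (fun u => w u ω) s)) := by
    filter_upwards [hw.continuous] with ω hω
    rw [noisePath_sub hg hω ⟨hs, hst.trans ht⟩ ⟨hs.trans hst, ht⟩]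
    exact tendsto_stratonovichSum hg (hω.mono (Icc_subset_Icc hs ht))
  have hmeas : ∀ p : Partition s t,
      StronglyMeasurable (stratonovichSum w (fun u _ => g u) p) := fun p =>
    stronglyMeasurable_stratonovichSum (fun u v hu huv hv =>
      (hw.stronglyMeasurable ⟨(hs.trans hu).trans huv, hv.trans ht⟩).sub
        (hw.stronglyMeasurable ⟨hs.trans hu, (huv.trans hv).trans ht⟩)) p
  have hconv : IsStratonovichIntegral P w (fun u _ => g u) s t fun ω =>
      noisePath g T (fun u => w u ω) t - noisePath g T (fun u => w u ω) s := by
    intro ε hε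
    -- Almost sure convergence implies convergence in measure only along sequences; the filter of
    -- partitions is countably generated.
    refine tendsto_of_seq_tendsto fun p hp => ?_
    refine tendstoInMeasure_of_tendsto_ae (fun n => (hmeas (p n)).aestronglyMeasurable) ?_ ε hε
    filter_upwards [hae] with ω hω using hω.comp hp
  constructor
  · intro hI
    obtain ⟨p, hp⟩ := Partition.exists_seq_tendsto_mesh hst
    exact tendstoInMeasure_ae_unique (f := fun n => stratonovichSum w (fun u _ => g u) (p n))
      (u := atTop) (fun ε hε => (hI ε hε).comp hp) (fun ε hε => (hconv ε hε).comp hp)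
  · intro hI
    exact TendstoInMeasure.congr_right (hI.mono fun ω hω => hω.symm) hconv

end Stratonovich

/-! ### Measurability of solutions with respect to a sub-σ-algebra -/

section Measurability

variable {Ω : Type*} {mΩ : MeasurableSpace Ω} {P : Measure Ω}
  {V : Type*} [NormedAddCommGroup V]

/-- The σ-algebra `𝓖` need not be comparable with the one on which `P` is defined. -/
theorem aestronglyMeasurable_of_ae_tendsto [CompleteSpace V] (𝓖 : MeasurableSpace Ω)
    {X : ℕ → Ω → V} {Y : Ω → V} (hX : ∀ n, AEStronglyMeasurable[𝓖] (X n) P)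
    (hlim : ∀ᵐ ω ∂P, Tendsto (fun n => X n ω) atTop (𝓝 (Y ω))) :
    AEStronglyMeasurable[𝓖] Y P := by
  refine ⟨fun ω => limUnder atTop fun n => (hX n).mk (X n) ω,
    StronglyMeasurable.limUnder fun n => (hX n).stronglyMeasurable_mk, ?_⟩
  filter_upwards [hlim, ae_all_iff.2 fun n => (hX n).ae_eq_mk] with ω hω heq
  exact (Tendsto.limUnder_eq (hω.congr heq)).symm

variable [NormedSpace ℝ V]

theorem aestronglyMeasurable_intervalIntegral [CompleteSpace V] (𝓖 : MeasurableSpace Ω) {a b : ℝ}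
    {Y : ℝ → Ω → V} (hY : ∀ u ∈ Icc a b, AEStronglyMeasurable[𝓖] (Y u) P)
    (hYc : ∀ᵐ ω ∂P, ContinuousOn (fun u => Y u ω) (Icc a b)) {s t : ℝ} (hs : s ∈ Icc a b)
    (ht : t ∈ Icc a b) : AEStronglyMeasurable[𝓖] (fun ω => ∫ u in s..t, Y u ω) P := by
  wlog hst : s ≤ t generalizing s t
  · have := this ht hs (le_of_not_ge hst)
    simp_rw [intervalIntegral.integral_symm t s]
    exact this.neg
  obtain ⟨p, hp⟩ := Partition.exists_seq_tendsto_mesh hst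
  have hsub : Icc s t ⊆ Icc a b := Icc_subset_Icc hs.1 ht.2
  refine aestronglyMeasurable_of_ae_tendsto 𝓖 (X := fun n ω => ∑ k : Fin (p n).N,
    ((p n).pt k.succ - (p n).pt k.castSucc) •
      ((1 / 2 : ℝ) • (Y ((p n).pt k.succ) ω + Y ((p n).pt k.castSucc) ω))) (fun n => ?_) ?_
  · have hk : ∀ k : Fin (p n).N, AEStronglyMeasurable[𝓖] (fun ω =>
        ((p n).pt k.succ - (p n).pt k.castSucc) •
          ((1 / 2 : ℝ) • (Y ((p n).pt k.succ) ω + Y ((p n).pt k.castSucc) ω))) P := by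
      intro k
      have hc : Continuous fun q : V × V => ((p n).pt k.succ - (p n).pt k.castSucc) •
          ((1 / 2 : ℝ) • (q.1 + q.2)) := by fun_prop
      exact hc.comp_aestronglyMeasurable
        ((hY _ (hsub ((p n).pt_mem k.succ))).prodMk (hY _ (hsub ((p n).pt_mem k.castSucc))))
    refine ⟨fun ω => ∑ k : Fin (p n).N, (hk k).mk _ ω,
      Finset.stronglyMeasurable_fun_sum _ fun k _ => (hk k).stronglyMeasurable_mk, ?_⟩
    filter_upwards [ae_all_iff.2 fun k => (hk k).ae_eq_mk] with ω hω
    exact Finset.sum_congr rfl fun k _ => hω k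
  · filter_upwards [hYc] with ω hω
    have := (Partition.tendsto_sum_integral
      (continuous_const (y := ContinuousLinearMap.id ℝ V)) (hω.mono hsub)).comp hp
    simpa only [Function.comp_def, ContinuousLinearMap.id_apply,
      intervalIntegral.integral_const] using this

/-- A process solving a Volterra equation with `𝓖`-measurable data is `𝓖`-measurable, being a limit
of Picard iterates. -/
theorem aestronglyMeasurable_of_volterra [CompleteSpace V] (𝓖 : MeasurableSpace Ω) {a b τ : ℝ}
    (hτ : τ ∈ Icc a b) {F : ℝ → V → Ω → V} {c x : ℝ → Ω → V}
    (hc : ∀ t ∈ Icc a b, AEStronglyMeasurable[𝓖] (c t) P)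
    (hF : ∀ t ∈ Icc a b, ∀ Y : Ω → V, AEStronglyMeasurable[𝓖] Y P →
      AEStronglyMeasurable[𝓖] (fun ω => F t (Y ω) ω) P)
    (hcc : ∀ᵐ ω ∂P, ContinuousOn (fun t => c t ω) (Icc a b))
    (hFc : ∀ᵐ ω ∂P, ContinuousOn (fun q : ℝ × V => F q.1 q.2 ω) (Icc a b ×ˢ univ))
    (hFL : ∃ K : ℝ, 0 ≤ K ∧ ∀ ω, ∀ t ∈ Icc a b, ∀ y z, ‖F t y ω - F t z ω‖ ≤ K * ‖y - z‖)
    (hxc : ∀ᵐ ω ∂P, ContinuousOn (fun t => x t ω) (Icc a b))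
    (hx : ∀ᵐ ω ∂P, ∀ t ∈ Icc a b, x t ω = c t ω + ∫ u in τ..t, F u (x u ω) ω)
    {t : ℝ} (ht : t ∈ Icc a b) : AEStronglyMeasurable[𝓖] (x t) P := by
  obtain ⟨K, hK, hFL⟩ := hFL
  have hiter : ∀ n : ℕ, ∀ t ∈ Icc a b, AEStronglyMeasurable[𝓖]
      (fun ω => picardIterate (fun u y => F u y ω) (fun u => c u ω) τ n t) P := by
    intro n
    induction n with
    | zero => exact hc
    | succ n ih =>
      intro t ht
      refine (hc t ht).add (aestronglyMeasurable_intervalIntegral 𝓖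
        (fun u hu => hF u hu _ (ih u hu)) ?_ hτ ht)
      filter_upwards [hcc, hFc] with ω h1 h2
      exact h2.comp (continuousOn_id.prodMk (continuousOn_picardIterate hτ h2 h1 n))
        fun u hu => ⟨hu, mem_univ _⟩
  refine aestronglyMeasurable_of_ae_tendsto 𝓖 (fun n => hiter n t ht) ?_
  filter_upwards [hcc, hFc, hxc, hx] with ω h1 h2 h3 h4
  exact tendsto_picardIterate hK hτ h2 (hFL ω) h1 h3 h4 ht

end Measurability

/-! ### Solutions and flows of the stochastic equation, path by path -/

section Flow

variable {Ω : Type*} {mΩ : MeasurableSpace Ω} {P : Measure Ω}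
  {𝓕 : Filtration ℝ mΩ} {d m : ℕ} {T : ℝ} {f : E d → ℝ → E d} {g : ℝ → E m →L[ℝ] E d}
  {w : ℝ → Ω → E m}

/-- Almost every path of a solution satisfies the integral equation driven by the noise path, at
all times simultaneously: both sides are continuous in time. -/
theorem SolvesSDE.ae_equation [IsProbabilityMeasure P] (hf : IsCbInfOne f) (hg : IsCbOne g)
    (hw : IsWienerProcess P 𝓕 T w) {𝓖 : ℝ → MeasurableSpace Ω} {s : ℝ} (hs : s ∈ Icc 0 T)
    {ξ : Ω → E d} {x : ℝ → Ω → E d} (hx : SolvesSDE P 𝓖 w f g s T ξ x) :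
    ∀ᵐ ω ∂P, ∀ t ∈ Icc s T, x t ω = x s ω
      + (noisePath g T (fun u => w u ω) t - noisePath g T (fun u => w u ω) s)
      + ∫ u in s..t, f (x u ω) u := by
  obtain ⟨D, hD, hDc, hDd⟩ :=
    (TopologicalSpace.IsSeparable.of_separableSpace (Icc s T)).exists_countable_dense_subset
  have hDeq : ∀ᵐ ω ∂P, ∀ t ∈ D, x t ω - x s ω - ∫ u in s..t, f (x u ω) u
      = noisePath g T (fun u => w u ω) t - noisePath g T (fun u => w u ω) s :=
    (ae_ball_iff hDc).2 fun t ht => (hw.isStratonovichIntegral_iff hg hs.1 (hD ht).1 (hD ht).2 _).1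
      (hx.equation t (hD ht))
  filter_upwards [hDeq, hx.continuous, hw.continuous] with ω h1 h2 h3
  have hsT : s ∈ uIcc s T := left_mem_uIcc
  have hint : ContinuousOn (fun t => ∫ u in s..t, f (x u ω) u) (Icc s T) := by
    have hc : ContinuousOn (fun u => f (x u ω) u) (uIcc s T) := by
      rw [uIcc_of_le hs.2]
      exact hf.continuous.comp_continuousOn (continuousOn_id.prodMk h2)
    have := intervalIntegral.continuousOn_primitive_interval' (μ := volume)
      hc.intervalIntegrable hsT
    rwa [uIcc_of_le hs.2] at this
  have hγ := (continuous_noisePath hg (hs.1.trans hs.2) h3).continuousOn (s := Icc s T)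
  refine EqOn.of_subset_closure (s := D) (fun t ht => ?_) h2
    ((continuousOn_const.add (hγ.sub continuousOn_const)).add hint) hD hDd
  rw [← h1 t ht]
  abel

/-- For almost every `ω` there is a flow driven by the noise path of `ω`. -/
theorem exists_ae_isPathFlow (hT : 0 ≤ T) (hf : IsCbInfOne f) (hg : IsCbOne g)
    (hw : IsWienerProcess P 𝓕 T w) :
    ∃ φ : Ω → ℝ → ℝ → E d → E d, ∀ᵐ ω ∂P,
      IsPathFlow (fun t x => f x t) (noisePath g T fun u => w u ω) (φ ω) := by
  obtain ⟨K, hK, hF⟩ := hf.exists_norm_sub_le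
  have : ∀ ω, ∃ φ : ℝ → ℝ → E d → E d, ContinuousOn (fun u => w u ω) (Icc 0 T) →
      IsPathFlow (fun t x => f x t) (noisePath g T fun u => w u ω) φ := by
    intro ω
    by_cases hω : ContinuousOn (fun u => w u ω) (Icc 0 T)
    · obtain ⟨φ, hφ⟩ := exists_isPathFlow hK hf.continuous hF (continuous_noisePath hg hT hω)
      exact ⟨φ, fun _ => hφ⟩
    -- Where the path of `w` is not continuous, the flow is an arbitrary family.
    · exact ⟨fun _ _ _ => 0, fun h => absurd h hω⟩
  choose φ hφ using this
  exact ⟨φ, hw.continuous.mono hφ⟩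

theorem stronglyMeasurable_increment {s t u v : ℝ} (hu : s ≤ u) (huv : u ≤ v) (hv : v ≤ t) :
    StronglyMeasurable[incrementSigma w s t] fun ω => w v ω - w u ω := by
  have hle : MeasurableSpace.comap (fun ω => w v ω - w u ω) inferInstance
      ≤ incrementSigma w s t :=
    le_iSup_of_le u (le_iSup_of_le v (le_iSup_of_le ⟨hu, huv, hv⟩ le_rfl))
  exact ((comap_measurable fun ω => w v ω - w u ω).mono hle le_rfl).stronglyMeasurable

theorem aestronglyMeasurable_noisePath_sub (hg : IsCbOne g) (hw : IsWienerProcess P 𝓕 T w)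
    {s t u v : ℝ} (hs : 0 ≤ s) (hu : s ≤ u) (huv : u ≤ v) (hv : v ≤ t) (ht : t ≤ T) :
    AEStronglyMeasurable[incrementSigma w s t] (fun ω =>
      noisePath g T (fun r => w r ω) v - noisePath g T (fun r => w r ω) u) P := by
  obtain ⟨p, hp⟩ := Partition.exists_seq_tendsto_mesh huv
  refine aestronglyMeasurable_of_ae_tendsto _ (fun n =>
    (stronglyMeasurable_stratonovichSum (g := g) (fun a b ha hab hb =>
      stronglyMeasurable_increment (hu.trans ha) hab (hb.trans hv)) (p n)).aestronglyMeasurable) ?_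
  filter_upwards [hw.continuous] with ω hω
  rw [noisePath_sub hg hω ⟨hs.trans hu, (huv.trans hv).trans ht⟩
    ⟨(hs.trans hu).trans huv, hv.trans ht⟩]
  exact (tendsto_stratonovichSum hg
    (hω.mono (Icc_subset_Icc (hs.trans hu) (hv.trans ht)))).comp hp

variable {φ : Ω → ℝ → ℝ → E d → E d}

theorem isStochasticFlow_of_isPathFlow [IsProbabilityMeasure P] (hT : 0 ≤ T)
    (hf : IsCbInfOne f) (hg : IsCbOne g) (hw : IsWienerProcess P 𝓕 T w) (hφ : ∀ᵐ ω ∂P,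
      IsPathFlow (fun t x => f x t) (noisePath g T fun u => w u ω) (φ ω)) :
    IsStochasticFlow P w f g T fun s t ξ ω => φ ω s t ξ := by
  obtain ⟨K, hK, hF⟩ := hf.exists_norm_sub_le
  refine ⟨?_, fun s hs ξ => ⟨fun t ht => ?_, ?_, ?_, fun t ht => ?_⟩⟩
  · filter_upwards [hφ] with ω h
    exact (h.continuous hK hf.continuous hF).continuousOn
  · refine aestronglyMeasurable_of_volterra (incrementSigma w s t) (a := s) (b := t) (τ := s)
      ⟨le_rfl, ht.1⟩ (F := fun u y _ => f y u) (x := fun u ω => φ ω s u ξ) (c := fun u ω => ξ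
        + (noisePath g T (fun r => w r ω) u - noisePath g T (fun r => w r ω) s))
      (fun u hu => ?_) (fun u _ Y hY => ?_) ?_ ?_ ⟨K, hK, fun _ u _ => hF u⟩ ?_ ?_ ⟨ht.1, le_rfl⟩
    · exact aestronglyMeasurable_const.add
        (aestronglyMeasurable_noisePath_sub hg hw hs.1 le_rfl hu.1 hu.2 ht.2)
    · exact (hf.differentiable u).continuous.comp_aestronglyMeasurable hY
    · filter_upwards [hw.continuous] with ω hω
      exact (continuous_const.add
        ((continuous_noisePath hg hT hω).sub continuous_const)).continuousOn
    · exact Eventually.of_forall fun _ => hf.continuous.continuousOn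
    · filter_upwards [hφ] with ω h using (h.continuous_time s ξ).continuousOn
    · filter_upwards [hφ] with ω h u _ using h.equation s u ξ
  · filter_upwards [hφ] with ω h using (h.continuous_time s ξ).continuousOn
  · filter_upwards [hφ] with ω h using h.self s ξ
  · refine (hw.isStratonovichIntegral_iff hg hs.1 ht.1 ht.2 _).2 ?_
    filter_upwards [hφ] with ω h
    rw [h.self, h.equation s t ξ]
    abel

/-- Pathwise uniqueness for the stochastic equation. -/
theorem SolvesSDE.ae_eq_pathFlow [IsProbabilityMeasure P] (hf : IsCbInfOne f) (hg : IsCbOne g)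
    (hw : IsWienerProcess P 𝓕 T w) (hφ : ∀ᵐ ω ∂P,
      IsPathFlow (fun t x => f x t) (noisePath g T fun u => w u ω) (φ ω))
    {𝓖 : ℝ → MeasurableSpace Ω} {s : ℝ} (hs : s ∈ Icc 0 T) {ξ : Ω → E d} {x : ℝ → Ω → E d}
    (hx : SolvesSDE P 𝓖 w f g s T ξ x) :
    ∀ᵐ ω ∂P, ∀ t ∈ Icc s T, x t ω = φ ω s t (x s ω) := by
  obtain ⟨K, hK, hF⟩ := hf.exists_norm_sub_le
  filter_upwards [hφ, hx.continuous, hx.ae_equation hf hg hw hs] with ω h h1 h2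
  exact h.eqOn_of_equation hK hf.continuous hF ⟨le_rfl, hs.2⟩ h1 h2

/-- A stochastic flow is indistinguishable from the flow driven by the noise path: they agree
almost surely at each point, and both are continuous. -/
theorem IsStochasticFlow.ae_eq_pathFlow [IsProbabilityMeasure P] (hf : IsCbInfOne f)
    (hg : IsCbOne g) (hw : IsWienerProcess P 𝓕 T w) (hφ : ∀ᵐ ω ∂P,
      IsPathFlow (fun t x => f x t) (noisePath g T fun u => w u ω) (φ ω))
    {Φ : ℝ → ℝ → E d → Ω → E d} (hΦ : IsStochasticFlow P w f g T Φ) :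
    ∀ᵐ ω ∂P, ∀ s t ξ, 0 ≤ s → s ≤ t → t ≤ T → Φ s t ξ ω = φ ω s t ξ := by
  obtain ⟨K, hK, hF⟩ := hf.exists_norm_sub_le
  obtain ⟨D, hD, hDc, hDd⟩ := (TopologicalSpace.IsSeparable.of_separableSpace
    {q : ℝ × ℝ × E d | 0 ≤ q.1 ∧ q.1 ≤ q.2.1 ∧ q.2.1 ≤ T}).exists_countable_dense_subset
  have hDeq : ∀ᵐ ω ∂P, ∀ q ∈ D, Φ q.1 q.2.1 q.2.2 ω = φ ω q.1 q.2.1 q.2.2 := by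
    refine (ae_ball_iff hDc).2 fun q hq => ?_
    obtain ⟨h0, h1, h2⟩ := hD hq
    have hs : q.1 ∈ Icc 0 T := ⟨h0, h1.trans h2⟩
    filter_upwards [(hΦ.solves q.1 hs q.2.2).ae_eq_pathFlow hf hg hw hφ hs,
      (hΦ.solves q.1 hs q.2.2).initial] with ω h3 h4
    rw [h3 q.2.1 ⟨h1, h2⟩, h4]
  filter_upwards [hDeq, hφ, hΦ.continuous] with ω h1 h2 h3 s t ξ hs hst ht
  exact EqOn.of_subset_closure (s := D) h1 h3
    (h2.continuous hK hf.continuous hF).continuousOn hD hDd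
    (show (s, t, ξ) ∈ {q : ℝ × ℝ × E d | 0 ≤ q.1 ∧ q.1 ≤ q.2.1 ∧ q.2.1 ≤ T} from ⟨hs, hst, ht⟩)

end Flow

/-! ### The adjoint process -/

section Adjoint

variable {Ω : Type*} {mΩ : MeasurableSpace Ω} {P : Measure Ω} [IsProbabilityMeasure P]
  {𝓕 : Filtration ℝ mΩ} {d m : ℕ} {T : ℝ} {f : E d → ℝ → E d} {g : ℝ → E m →L[ℝ] E d}
  {w : ℝ → Ω → E m}

/-- The pathwise form of the adjoint equation. Almost every path of the solution `x` extends to a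
continuous `X` on the line that solves the integral equation from the terminal time backwards, and
the adjoint process extends to a solution `a` on the line of the adjoint equation. -/
theorem SolvesSDE.ae_exists_adjoint (hT : 0 ≤ T) (hf : IsCbInfOne f) (hg : IsCbOne g)
    (hw : IsWienerProcess P 𝓕 T w) {𝓖 : ℝ → MeasurableSpace Ω} {ξ : Ω → E d} {x : ℝ → Ω → E d}
    (hx : SolvesSDE P 𝓖 w f g 0 T ξ x) {L : E d → ℝ} (hL : Differentiable ℝ L)
    {Φ : ℝ → ℝ → E d → Ω → E d} (hΦ : IsStochasticFlow P w f g T Φ) :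
    ∀ᵐ ω ∂P, ∃ (X : ℝ → E d) (a : ℝ → E d →L[ℝ] ℝ), Continuous X ∧
      (∀ t ∈ Icc 0 T, x t ω = X t) ∧
      (∀ t, X t = X T + (noisePath g T (fun u => w u ω) t - noisePath g T (fun u => w u ω) T)
        + ∫ u in T..t, f (X u) u) ∧
      a T = fderiv ℝ L (x T ω) ∧
      (∀ t, HasDerivAt a (-((a t).comp (fderiv ℝ (fun y => f y t) (X t)))) t) ∧
      ∀ t ∈ Icc 0 T, Φ t T (x t ω) ω = x T ω ∧
        HasFDerivAt (fun η => L (Φ t T η ω)) (a t) (x t ω) := by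
  obtain ⟨K, hK, hF⟩ := hf.exists_norm_sub_le
  obtain ⟨φ, hφ⟩ := exists_ae_isPathFlow hT hf hg hw
  filter_upwards [hφ, hx.ae_eq_pathFlow hf hg hw hφ ⟨le_rfl, hT⟩,
    hΦ.ae_eq_pathFlow hf hg hw hφ] with ω h hxφ hΦφ
  obtain ⟨R, hRT, hR, hDφ⟩ := h.exists_hasFDerivAt hf 0 T (x 0 ω)
  have hcomp : ∀ t ∈ Icc 0 T, φ ω t T (x t ω) = x T ω := fun t ht => by
    rw [hxφ t ht, h.comp hK hf.continuous hF, ← hxφ T ⟨hT, le_rfl⟩]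
  refine ⟨fun t => φ ω 0 t (x 0 ω), fun t => (fderiv ℝ L (x T ω)).comp (R t),
    h.continuous_time 0 _, hxφ, fun t => h.equation_restart hf.continuous 0 T t _, by simp [hRT],
    fun t => ?_, fun t ht => ⟨?_, ?_⟩⟩
  · refine ((hasDerivAt_const t (fderiv ℝ L (x T ω))).clm_comp (hR t)).congr_deriv ?_
    simp [ContinuousLinearMap.comp_assoc]
  · rw [hΦφ t T _ ht.1 ht.2 le_rfl, hcomp t ht]
  · have heq : (fun η => L (Φ t T η ω)) = fun η => L (φ ω t T η) := by
      funext η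
      rw [hΦφ t T _ ht.1 ht.2 le_rfl]
    rw [heq]
    have h1 := hDφ t
    rw [← hxφ t ht] at h1
    have h2 : HasFDerivAt L (fderiv ℝ L (x T ω)) (φ ω t T (x t ω)) := by
      rw [hcomp t ht]
      exact (hL _).hasFDerivAt
    exact h2.comp (x t ω) h1

/-- The adjoint process at time `t` depends only on `x T` and on the increments of the noise
after `t`: the state on `[t, T]` is recovered from `x T` by solving the equation backwards, and
the adjoint equation is then solved backwards along it. -/
theorem aestronglyMeasurable_adjointProcess (hT : 0 ≤ T) (hf : IsCbInfOne f) (hg : IsCbOne g)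
    (hw : IsWienerProcess P 𝓕 T w) {𝓖 : ℝ → MeasurableSpace Ω} {ξ : Ω → E d} {x : ℝ → Ω → E d}
    (hx : SolvesSDE P 𝓖 w f g 0 T ξ x) {L : E d → ℝ} (hL : Differentiable ℝ L)
    {Φ : ℝ → ℝ → E d → Ω → E d} (hΦ : IsStochasticFlow P w f g T Φ) {t : ℝ}
    (ht : t ∈ Icc 0 T) :
    AEStronglyMeasurable[MeasurableSpace.comap (x T) inferInstance ⊔ incrementSigma w t T]
      (adjointProcess L Φ T x t) P := by
  set 𝓗 : MeasurableSpace Ω := MeasurableSpace.comap (x T) inferInstance ⊔ incrementSigma w t T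
    with h𝓗
  obtain ⟨K, hK, hF⟩ := hf.exists_norm_sub_le
  obtain ⟨K', hK', hJ⟩ := hf.exists_norm_fderiv_le
  have hae := hx.ae_exists_adjoint hT hf hg hw hL hΦ
  have hTmem : T ∈ Icc t T := ⟨ht.2, le_rfl⟩
  have hsub : Icc t T ⊆ Icc 0 T := Icc_subset_Icc ht.1 le_rfl
  have hsub' : ∀ u ∈ Icc t T, uIcc T u ⊆ Icc 0 T := fun u hu =>
    (uIcc_subset_Icc hTmem hu).trans hsub
  have hxT : Measurable[𝓗] (x T) := (comap_measurable (x T)).mono le_sup_left le_rfl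
  have hstate : ∀ u ∈ Icc t T, AEStronglyMeasurable[𝓗] (x u) P := by
    intro u hu
    refine aestronglyMeasurable_of_volterra 𝓗 (a := t) (b := T) (τ := T) hTmem
      (F := fun r y _ => f y r) (c := fun r ω => x T ω
        + (noisePath g T (fun v => w v ω) r - noisePath g T (fun v => w v ω) T))
      (fun r hr => ?_) (fun r _ Y hY => ?_) ?_ ?_ ⟨K, hK, fun _ r _ => hF r⟩ ?_ ?_ hu
    · have h1 := (aestronglyMeasurable_noisePath_sub hg hw ht.1 hr.1 hr.2 le_rfl le_rfl).neg
      have h2 := (h1.mono (le_sup_right (a := MeasurableSpace.comap (x T) inferInstance)))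
      refine hxT.stronglyMeasurable.aestronglyMeasurable.add (h2.congr ?_)
      exact Eventually.of_forall fun ω => neg_sub _ _
    · exact (hf.differentiable r).continuous.comp_aestronglyMeasurable hY
    · filter_upwards [hw.continuous] with ω hω
      exact (continuous_const.add
        ((continuous_noisePath hg hT hω).sub continuous_const)).continuousOn
    · exact Eventually.of_forall fun _ => hf.continuous.continuousOn
    · filter_upwards [hx.continuous] with ω hω using hω.mono hsub
    · filter_upwards [hae] with ω ⟨X, a, hXc, hxX, hX, _⟩ r hr
      have hint : ∫ v in T..r, f (x v ω) v = ∫ v in T..r, f (X v) v :=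
        intervalIntegral.integral_congr fun v hv => by
          simp only [hxX v (hsub' r hr hv)]
      rw [hint, hxX r (hsub hr), hxX T (hsub hTmem)]
      exact hX r
  refine aestronglyMeasurable_of_volterra 𝓗 (a := t) (b := T) (τ := T) hTmem
    (F := fun u A ω => -(A.comp (fderiv ℝ (fun y => f y u) (x u ω))))
    (c := fun _ ω => fderiv ℝ L (x T ω)) (fun _ _ => ?_) (fun u hu Y hY => ?_)
    (Eventually.of_forall fun _ => continuousOn_const) ?_
    ⟨K', hK', fun ω u _ A B => ?_⟩ ?_ ?_ ⟨le_rfl, ht.2⟩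
  · exact ((measurable_fderiv ℝ L).comp hxT).stronglyMeasurable.aestronglyMeasurable
  · have hc : Continuous fun q : (E d →L[ℝ] ℝ) × E d =>
        -(q.1.comp (fderiv ℝ (fun y => f y u) q.2)) := by
      have : Continuous fun z : E d => fderiv ℝ (fun y => f y u) z :=
        hf.continuous_fderiv.comp (continuous_const.prodMk continuous_id)
      fun_prop
    exact hc.comp_aestronglyMeasurable (hY.prodMk (hstate u hu))
  · filter_upwards [hx.continuous] with ω hω
    have hJc : ContinuousOn (fun q : ℝ × (E d →L[ℝ] ℝ) => fderiv ℝ (fun y => f y q.1) (x q.1 ω))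
        (Icc t T ×ˢ univ) :=
      hf.continuous_fderiv.comp_continuousOn (continuousOn_fst.prodMk
        ((hω.mono hsub).comp continuousOn_fst fun q hq => hq.1))
    exact (continuousOn_snd.clm_comp hJc).neg
  · rw [neg_sub_neg, norm_sub_rev, ← ContinuousLinearMap.sub_comp, mul_comm]
    exact (ContinuousLinearMap.opNorm_comp_le _ _).trans
      (mul_le_mul_of_nonneg_left (hJ _ _) (norm_nonneg _))
  · filter_upwards [hae] with ω ⟨X, a, _, _, _, _, ha, hΦa⟩
    have hac : Continuous a := continuous_iff_continuousAt.2 fun u => (ha u).continuousAt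
    exact hac.continuousOn.congr fun u hu => (hΦa u (hsub hu)).2.fderiv
  · filter_upwards [hae] with ω ⟨X, a, hXc, hxX, _, haT, ha, hΦa⟩ u hu
    have hac : Continuous a := continuous_iff_continuousAt.2 fun u => (ha u).continuousAt
    have hval : ∀ v ∈ Icc 0 T, adjointProcess L Φ T x v ω = a v := fun v hv =>
      (hΦa v hv).2.fderiv
    have hint : ∫ v in T..u, -((adjointProcess L Φ T x v ω).comp
          (fderiv ℝ (fun y => f y v) (x v ω)))
        = ∫ v in T..u, -((a v).comp (fderiv ℝ (fun y => f y v) (X v))) :=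
      intervalIntegral.integral_congr fun v hv => by
        simp only [hval v (hsub' u hu hv), hxX v (hsub' u hu hv)]
    have hJc : Continuous fun v => fderiv ℝ (fun y => f y v) (X v) :=
      hf.continuous_fderiv.comp (continuous_id.prodMk hXc)
    have hcont : Continuous fun v => -((a v).comp (fderiv ℝ (fun y => f y v) (X v))) :=
      (hac.clm_comp hJc).neg
    rw [hint, intervalIntegral.integral_eq_sub_of_hasDerivAt (fun v _ => ha v)
      (hcont.intervalIntegrable _ _), hval u (hsub hu), haT]
    abel

end Adjoint

end AdjointSDE

theorem mainTheorem4 {Ω : Type*} {mΩ : MeasurableSpace Ω} (P : Measure Ω) [IsProbabilityMeasure P]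
    (𝓕 : Filtration ℝ mΩ) {d m : ℕ} (T : ℝ) (hT : 0 < T)
    (f : AdjointSDE.E d → ℝ → AdjointSDE.E d) (hf : AdjointSDE.IsCbInfOne f)
    (g : ℝ → AdjointSDE.E m →L[ℝ] AdjointSDE.E d) (hg : AdjointSDE.IsCbOne g)
    (L : AdjointSDE.E d → ℝ) (hL : Differentiable ℝ L)
    (w : ℝ → Ω → AdjointSDE.E m) (hw : AdjointSDE.IsWienerProcess P 𝓕 T w)
    (x₀ : Ω → AdjointSDE.E d) (x : ℝ → Ω → AdjointSDE.E d)
    (hx : AdjointSDE.SolvesSDE P (fun t => 𝓕 t) w f g 0 T x₀ x) :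
    (∃ Φ : ℝ → ℝ → AdjointSDE.E d → Ω → AdjointSDE.E d,
      AdjointSDE.IsStochasticFlow P w f g T Φ) ∧
    ∀ Φ : ℝ → ℝ → AdjointSDE.E d → Ω → AdjointSDE.E d,
      AdjointSDE.IsStochasticFlow P w f g T Φ →
      (∀ᵐ ω ∂P, ∀ t ∈ Icc 0 T, Φ t T (x t ω) ω = x T ω ∧
        DifferentiableAt ℝ (fun ξ => L (Φ t T ξ ω)) (x t ω)) ∧
      AdjointSDE.IsStrongBackwardSolution P
        (fun t => MeasurableSpace.comap (x T) inferInstance ⊔ AdjointSDE.incrementSigma w t T) T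
        (fun t ω => fderiv ℝ (fun y => f y t) (x t ω))
        (fun ω => fderiv ℝ L (x T ω))
        (AdjointSDE.adjointProcess L Φ T x) := by
  constructor
  · obtain ⟨φ, hφ⟩ := AdjointSDE.exists_ae_isPathFlow hT.le hf hg hw
    exact ⟨_, AdjointSDE.isStochasticFlow_of_isPathFlow hT.le hf hg hw hφ⟩
  intro Φ hΦ
  have hae := hx.ae_exists_adjoint hT.le hf hg hw hL hΦ
  refine ⟨?_, fun t ht => AdjointSDE.aestronglyMeasurable_adjointProcess hT.le hf hg hw hx hL hΦ ht,
    ?_, ?_⟩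
  · filter_upwards [hae] with ω ⟨X, a, _, _, _, _, _, hΦa⟩ t ht
    exact ⟨(hΦa t ht).1, (hΦa t ht).2.differentiableAt⟩
  · filter_upwards [hae] with ω ⟨X, a, _, _, _, haT, _, hΦa⟩
    exact (hΦa T ⟨hT.le, le_rfl⟩).2.fderiv.trans haT
  · filter_upwards [hae] with ω ⟨X, a, _, hxX, _, _, ha, hΦa⟩ t ht
    have hval : ∀ u ∈ Icc 0 T, AdjointSDE.adjointProcess L Φ T x u ω = a u := fun u hu =>
      (hΦa u hu).2.fderiv
    rw [hval t ht, hxX t ht]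
    exact (ha t).hasDerivWithinAt.congr hval (hval t ht)
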